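/- **Definitions.** All manifolds are smooth (Hausdorff, second countable). An almost $2$-Kähler manifold of dimension $3n$ is $(X,\omega_1,\omega_2,\mathbf g)$ with $\mathbf g$ a Riemannian metric and $\omega_1,\omega_2$ closed $2$-forms such that at every point there is an orthonormal basis $v_i,w^1_i,w^2_i$ ($1\le i\le n$) of the tangent space (an adapted basis) with $\omega_j=\sum_i v_i^*\wedge (w^j_i)^*$ for $j=1,2$, and such that the distribution $\omega_1^\perp+\omega_2^\perp$ is integrable, where $\omega^\perp$ is the space of vectors contracting to zero with $\omega$. It is self-dual if the form $\omega_D=\sum_i (w^1_i)^*\wedge (w^2_i)^*$ (independent of the adapted basis) is closed and all leaves of $\omega_1^\perp+\omega_2^\perp$ have Riemannian volume $1$. An elliptic curve with complexified Kähler class is a pair $\mathbf E=(\mathbb C/\Lambda,\omega)$, where $\Lambda\subset\mathbb C$ is a lattice and $\omega=\kappa\,dz\wedge d\bar z$ with $\operatorname{Im}\kappa<0$. Its Kähler form is $\operatorname{Re}\omega$, its Kähler metric is $-2\operatorname{Im}(\kappa)\,|dz|^2$, and its $B$-field is $\operatorname{Im}\omega$, taken modulo integral classes: $\mathbf E\cong\mathbf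 E'$ means that there is a biholomorphic map between the curves and that $\int\omega'-\int\omega\in i\mathbb Z$. For $\tau,t\in\mathbb H$ let $$\mathbf E_{\tau,t}=\Big(\mathbb C/(\mathbb Z\tau\oplus\mathbb Z),\ -\tfrac{t}{2\operatorname{Im}\tau}\,dz\wedge d\bar z\Big).$$ $\mathbf E_1,\mathbf E_2$ form a mirror pair if $\mathbf E_1\cong\mathbf E_{\tau,t}$ and $\mathbf E_2\cong\mathbf E_{t,\tau}$ for some $\tau,t\in\mathbb H$. Let $B=\mathbb R/\mathbb Z$, let $E_\tau\to B$ be the map $[z]\mapsto[\operatorname{Im}z/\operatorname{Im}\tau]$, and similarly $E_t\to B$. Let $\mathbf X_{\tau,t}$ be the $3$-manifold $E_\tau\times_B E_t$, where $\omega_1,\omega_2$ are the pull-backs of the Kähler forms of $\mathbf E_{\tau,t}$ and $\mathbf E_{t,\tau}$, and where $\mathbf g$ is the restriction of the product of the two Kähler metrics, with squared lengths halved on the orthogonal complement of the fibres over $B$. Let $\mathbf X=(X,\omega_1,\omega_2,\mathbf g)$ be a manifold of dimension $3$ with two $2$-forms and a metric. Write $\mathbf X\to_1\mathbf E$ if *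 $E$ is the smooth quotient $X/\omega_1^\perp$ of $X$ by the leaves of $\omega_1^\perp$: there is a surjective submersion $\pi:X\to E$ whose fibres are exactly these leaves; * $\omega_1$ is the pull-back by $\pi$ of the Kähler form of $\mathbf E$, and $\pi$ is a Riemannian submersion for $\mathbf g$ and the Kähler metric of $\mathbf E$; * $\int_E\operatorname{Im}\omega$ modulo $\mathbb Z$ is the monodromy of the circle fibration $X/\omega_2^\perp\to X/(\omega_1^\perp+\omega_2^\perp)$ around its base, that is, the fraction of the fibre by which the end point of the horizontal lift of the base loop must be moved along the fibre to close the lift up (the base oriented by $v$ and the fibre by $w^2$, for an adapted basis $v,w^1,w^2$). Write $\mathbf X\to_2\mathbf E$ for the same relation with $\omega_1$ and $\omega_2$ exchanged. **Theorem.** 1. For all $(\tau,t)\in\mathbb H\times\mathbb H$, $\mathbf X_{\tau,t}$ is a self-dual manifold. 2. $\mathbf X_{\tau,t}$ determines $\mathbf E_{\tau,t}$ and $\mathbf E_{t,\tau}$: if $\mathbf X$ is isomorphic to $\mathbf X_{\tau,t}$ (by a diffeomorphism compatible with $\omega_1,\omega_2,\mathbf g$), then for every elliptic curve with complexified Kähler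 class $\mathbf E$, $$\mathbf X\to_1\mathbf E\iff\mathbf E\cong\mathbf E_{\tau,t},\qquad \mathbf X\to_2\mathbf E\iff\mathbf E\cong\mathbf E_{t,\tau}.$$ 3. Let $\mathbf E_1,\mathbf E_2$ be elliptic curves with complexified Kähler classes. Then $\mathbf E_1$ and $\mathbf E_2$ form a mirror pair if and only if there are $\tau,t\in\mathbb H$ such that $\mathbf X_{\tau,t}$ is self-dual, $\mathbf X_{\tau,t}\to_1\mathbf E_1$ and $\mathbf X_{\tau,t}\to_2\mathbf E_2$. -/

import Mathlib

open Set Function Module MeasureTheory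
open scoped Manifold ContDiff Topology ENNReal

noncomputable section

/-! ### Manifolds with two 2-forms and a metric -/

section General

variable {V : Type*} [NormedAddCommGroup V] [NormedSpace ℝ V]
variable {X : Type*} [TopologicalSpace X] [ChartedSpace V X]

variable (V X) in
/-- A field of real 2-forms on a manifold `X` modelled on `V`. -/
abbrev TwoFormField : Type _ :=
  (p : X) → TangentSpace 𝓘(ℝ, V) p [⋀^Fin 2]→L[ℝ] ℝ

variable (V X) in
/-- A field of subspaces of the tangent spaces. -/
abbrev TangentDistribution : Type _ :=
  (p : X) → Submodule ℝ (TangentSpace 𝓘(ℝ, V) p)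

namespace TwoFormField

/-- The expression of a 2-form in the chart `e`, i.e. its pull-back by `e.symm`. -/
def inChart (η : TwoFormField V X) (e : OpenPartialHomeomorph X V) :
    V → V [⋀^Fin 2]→L[ℝ] ℝ := fun y =>
  (η (e.symm y)).compContinuousLinearMap (mfderiv 𝓘(ℝ, V) 𝓘(ℝ, V) e.symm y)

/-- The 2-form is smooth. -/
def IsSmooth (η : TwoFormField V X) : Prop :=
  ∀ e ∈ atlas V X, ContDiffOn ℝ ∞ (inChart η e) e.target

/-- The exterior derivative of the 2-form vanishes. -/
def IsClosed (η : TwoFormField V X) : Prop :=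
  ∀ e ∈ atlas V X, ∀ y ∈ e.target, extDeriv (inChart η e) y = 0

/-- `η^⊥`: the vectors which contract to zero with the 2-form `η`. -/
def perp (η : TwoFormField V X) : TangentDistribution V X := fun p =>
  { carrier := {u | ∀ u', η p ![u, u'] = 0}
    add_mem' := by
      intro a b ha hb u'
      have h := (η p).toMultilinearMap.cons_add ![u'] a b
      have h' : η p ![a + b, u'] = η p ![a, u'] + η p ![b, u'] := h
      rw [h', ha u', hb u', add_zero]
    zero_mem' := by
      intro u'
      exact (η p).map_coord_zero 0 rfl
    smul_mem' := by
      intro c a ha u'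
      have h := (η p).toMultilinearMap.cons_smul ![u'] c a
      have h' : η p ![c • a, u'] = c • η p ![a, u'] := h
      rw [h', ha u', smul_zero] }

end TwoFormField

/-- The velocity of a curve. -/
def velocity (γ : ℝ → X) (s : ℝ) : TangentSpace 𝓘(ℝ, V) (γ s) :=
  mfderiv 𝓘(ℝ, ℝ) 𝓘(ℝ, V) γ s (1 : ℝ)

namespace TangentDistribution

/-- Integrability: near every point there is a smooth chart in which the distribution
becomes a constant subspace of the model space. -/
def IsIntegrable (D : TangentDistribution V X) : Prop :=
  ∀ p : X, ∃ e ∈ IsManifold.maximalAtlas 𝓘(ℝ, V) ∞ X, p ∈ e.source ∧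
    ∃ F : Submodule ℝ V, ∀ q ∈ e.source,
      (D q).map (mfderiv 𝓘(ℝ, V) 𝓘(ℝ, V) e q).toLinearMap = F

/-- The leaf through `p`: all points which are joined to `p` by a smooth curve tangent to the
distribution. -/
def leaf (D : TangentDistribution V X) (p : X) : Set X :=
  {q | ∃ γ : ℝ → X, ContMDiff 𝓘(ℝ, ℝ) 𝓘(ℝ, V) ∞ γ ∧
    (∀ s, velocity (V := V) γ s ∈ D (γ s)) ∧ γ 0 = p ∧ γ 1 = q}

end TangentDistribution

/-- `S`, a (possibly only immersed) `k`-dimensional submanifold, has `k`-dimensional Riemannian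
volume `v` for the metric induced by `g`: it can be cut into countably many measurable pieces
`φ i '' A i`, each parametrized by an immersion `φ i` of an open subset of `ℝ^k`, and the integrals
of the volume densities `√det(g(∂_a φ_i, ∂_b φ_i))` add up to `v`.  By the change of variables
formula `v` does not depend on the pieces. -/
def HasRiemannianVolume
    (g : (p : X) → TangentSpace 𝓘(ℝ, V) p →L[ℝ] TangentSpace 𝓘(ℝ, V) p →L[ℝ] ℝ)
    (k : ℕ) (S : Set X) (v : ℝ≥0∞) : Prop :=
  ∃ (φ : ℕ → EuclideanSpace ℝ (Fin k) → X) (U A : ℕ → Set (EuclideanSpace ℝ (Fin k))),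
    (∀ i, IsOpen (U i) ∧
      ContMDiffOn 𝓘(ℝ, EuclideanSpace ℝ (Fin k)) 𝓘(ℝ, V) ∞ (φ i) (U i) ∧
      (∀ y ∈ U i, Injective (mfderiv 𝓘(ℝ, EuclideanSpace ℝ (Fin k)) 𝓘(ℝ, V) (φ i) y)) ∧
      MeasurableSet (A i) ∧ A i ⊆ U i ∧ InjOn (φ i) (A i)) ∧
    Pairwise (fun i j => Disjoint (φ i '' A i) (φ j '' A j)) ∧
    (⋃ i, φ i '' A i) = S ∧
    ∑' i, ∫⁻ y in A i, ENNReal.ofReal (Real.sqrt (Matrix.det (Matrix.of fun a b : Fin k =>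
      g (φ i y)
        (mfderiv 𝓘(ℝ, EuclideanSpace ℝ (Fin k)) 𝓘(ℝ, V) (φ i) y
          (EuclideanSpace.single a (1 : ℝ)))
        (mfderiv 𝓘(ℝ, EuclideanSpace ℝ (Fin k)) 𝓘(ℝ, V) (φ i) y
          (EuclideanSpace.single b (1 : ℝ)))))) = v

variable (V X) in
/-- The data `(ω₁, ω₂, g)` on a manifold `X`; the conditions on these data are imposed by
`IsAlmostTwoKahler` and `IsSelfDual` below. -/
structure TwoFormsWithMetric where
  ω₁ : TwoFormField V X
  ω₂ : TwoFormField V X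
  g : (p : X) → TangentSpace 𝓘(ℝ, V) p →L[ℝ] TangentSpace 𝓘(ℝ, V) p →L[ℝ] ℝ

namespace TwoFormsWithMetric

/-- Exchange of the two forms. -/
def swap (D : TwoFormsWithMetric V X) : TwoFormsWithMetric V X := ⟨D.ω₂, D.ω₁, D.g⟩

/-- The distribution `ω₁^⊥ + ω₂^⊥`. -/
def vertical (D : TwoFormsWithMetric V X) : TangentDistribution V X :=
  fun p => TwoFormField.perp D.ω₁ p ⊔ TwoFormField.perp D.ω₂ p

/-- `b` is an orthonormal standard polysymplectic basis of the tangent space at `p`.  The vectors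
`v_i, w^1_i, w^2_i` are `b (0, i), b (1, i), b (2, i)`, and the condition on the forms is
`ω_j = ∑ i, v_i^* ∧ (w^j_i)^*`. -/
def IsAdaptedBasis (D : TwoFormsWithMetric V X) {n : ℕ} (p : X)
    (b : Basis (Fin 3 × Fin n) ℝ (TangentSpace 𝓘(ℝ, V) p)) : Prop :=
  (∀ u u', D.ω₁ p ![u, u'] = ∑ i : Fin n,
    (b.coord (0, i) u * b.coord (1, i) u' - b.coord (0, i) u' * b.coord (1, i) u)) ∧
  (∀ u u', D.ω₂ p ![u, u'] = ∑ i : Fin n,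
    (b.coord (0, i) u * b.coord (2, i) u' - b.coord (0, i) u' * b.coord (2, i) u)) ∧
  ∀ k l, D.g p (b k) (b l) = if k = l then 1 else 0

/-- `(X, ω₁, ω₂, g)` is an almost 2-Kähler manifold of dimension `3n`: a polysymplectic manifold
with a compatible Riemannian metric. -/
structure IsAlmostTwoKahler [IsManifold 𝓘(ℝ, V) ∞ X] (n : ℕ)
    (D : TwoFormsWithMetric V X) : Prop where
  t2 : T2Space X
  secondCountable : SecondCountableTopology X
  smooth₁ : TwoFormField.IsSmooth D.ω₁
  smooth₂ : TwoFormField.IsSmooth D.ω₂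
  closed₁ : TwoFormField.IsClosed D.ω₁
  closed₂ : TwoFormField.IsClosed D.ω₂
  riemannian : ∃ G : Bundle.ContMDiffRiemannianMetric 𝓘(ℝ, V) ∞ V
    (fun p : X => TangentSpace 𝓘(ℝ, V) p), ∀ p, G.inner p = D.g p
  adapted : ∀ p : X, ∃ b : Basis (Fin 3 × Fin n) ℝ (TangentSpace 𝓘(ℝ, V) p),
    D.IsAdaptedBasis p b
  integrable : D.vertical.IsIntegrable

/-- `ω` is the dualizing form: `η = ∑ i, (w^1_i)^* ∧ (w^2_i)^*` for every orthonormal standard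
polysymplectic basis. -/
def IsDualizingForm (D : TwoFormsWithMetric V X) (n : ℕ) (η : TwoFormField V X) : Prop :=
  ∀ (p : X) (b : Basis (Fin 3 × Fin n) ℝ (TangentSpace 𝓘(ℝ, V) p)), D.IsAdaptedBasis p b →
    ∀ u u', η p ![u, u'] = ∑ i : Fin n,
      (b.coord (1, i) u * b.coord (2, i) u' - b.coord (1, i) u' * b.coord (2, i) u)

/-- `(X, ω₁, ω₂, g)` is a self-dual manifold: the dualizing form is a closed differential form and
all leaves of `ω₁^⊥ + ω₂^⊥` have Riemannian volume one. -/
structure IsSelfDual [IsManifold 𝓘(ℝ, V) ∞ X] (n : ℕ) (D : TwoFormsWithMetric V X) : Prop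
    extends IsAlmostTwoKahler n D where
  dualizing_closed : ∃ η : TwoFormField V X, D.IsDualizingForm n η ∧ η.IsSmooth ∧ η.IsClosed
  leaf_volume : ∀ p : X, HasRiemannianVolume D.g (2 * n) (D.vertical.leaf p) 1

/-- Isomorphism: a diffeomorphism compatible with the forms and the metrics. -/
def Isomorphic {W : Type*} [NormedAddCommGroup W] [NormedSpace ℝ W] {Y : Type*}
    [TopologicalSpace Y] [ChartedSpace W Y]
    (D : TwoFormsWithMetric V X) (D' : TwoFormsWithMetric W Y) : Prop :=
  ∃ Φ : Diffeomorph 𝓘(ℝ, V) 𝓘(ℝ, W) X Y ∞, ∀ (p : X) (u u' : TangentSpace 𝓘(ℝ, V) p),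
    D'.ω₁ (Φ p) ![mfderiv 𝓘(ℝ, V) 𝓘(ℝ, W) Φ p u, mfderiv 𝓘(ℝ, V) 𝓘(ℝ, W) Φ p u']
      = D.ω₁ p ![u, u'] ∧
    D'.ω₂ (Φ p) ![mfderiv 𝓘(ℝ, V) 𝓘(ℝ, W) Φ p u, mfderiv 𝓘(ℝ, V) 𝓘(ℝ, W) Φ p u']
      = D.ω₂ p ![u, u'] ∧
    D'.g (Φ p) (mfderiv 𝓘(ℝ, V) 𝓘(ℝ, W) Φ p u) (mfderiv 𝓘(ℝ, V) 𝓘(ℝ, W) Φ p u')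
      = D.g p u u'

/-- For `X` of dimension 3 (`n = 1`, adapted bases `v, w^1, w^2`), `θ` (a real number, to be read
modulo `ℤ`) is the monodromy of the circle fibration
`X / ω₂^⊥ → B = X / (ω₁^⊥ + ω₂^⊥)` around `B`.

The curve `γ` is tangent to `v`, hence orthogonal to the leaves of `ω₁^⊥ + ω₂^⊥`; its image in
`X / ω₂^⊥` is a horizontal lift of the loop which runs once around `B`, where `L` is the length of
`B`.  The curve `δ` is tangent to `w^2`; its image in `X / ω₂^⊥` is the fibre of the fibration, run
through at unit speed, and `ℓ` is the length of that fibre.  The orientations of the two curves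
are matched by `ω₂(γ', δ') = 1`.  The end point of the horizontal lift has to be moved by `θ` times
the length of the fibre to come back to the starting point. -/
def IsMonodromy (D : TwoFormsWithMetric V X) (θ : ℝ) : Prop :=
  ∃ (γ δ : ℝ → X) (L ℓ : ℝ),
    ContMDiff 𝓘(ℝ, ℝ) 𝓘(ℝ, V) ∞ γ ∧
    (∀ s, ∃ b : Basis (Fin 3 × Fin 1) ℝ (TangentSpace 𝓘(ℝ, V) (γ s)),
      D.IsAdaptedBasis (γ s) b ∧ velocity (V := V) γ s = b (0, 0)) ∧
    0 < L ∧ γ L ∈ D.vertical.leaf (γ 0) ∧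
    (∀ s, 0 < s → s < L → γ s ∉ D.vertical.leaf (γ 0)) ∧
    ContMDiff 𝓘(ℝ, ℝ) 𝓘(ℝ, V) ∞ δ ∧
    (∀ s, ∃ b : Basis (Fin 3 × Fin 1) ℝ (TangentSpace 𝓘(ℝ, V) (δ s)),
      D.IsAdaptedBasis (δ s) b ∧ velocity (V := V) δ s = b (2, 0)) ∧
    δ 0 = γ L ∧ D.ω₂ (γ L) ![velocity (V := V) γ L, velocity (V := V) δ 0] = 1 ∧
    0 < ℓ ∧ δ ℓ ∈ (TwoFormField.perp D.ω₂).leaf (δ 0) ∧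
    (∀ s, 0 < s → s < ℓ → δ s ∉ (TwoFormField.perp D.ω₂).leaf (δ 0)) ∧
    δ (θ * ℓ) ∈ (TwoFormField.perp D.ω₂).leaf (γ 0)

end TwoFormsWithMetric

end General

/-! ### Quotients by discrete groups of translations -/

/-- A group which is covered by a normed space through a homomorphism is a manifold when its charts
are local inverses of the covering. -/
theorem isManifold_of_addMonoidHom {𝕜 : Type*} [NontriviallyNormedField 𝕜]
    {V : Type*} [NormedAddCommGroup V] [NormedSpace 𝕜 V]
    {X : Type*} [TopologicalSpace X] [AddCommGroup X] (c : V →+ X)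
    (hc : IsLocalHomeomorph c) (hs : Surjective c) (n : WithTop ℕ∞) :
    @IsManifold 𝕜 _ V _ _ V _ 𝓘(𝕜, V) n X _ (hc.chartedSpace hs) := by
  let _ : ChartedSpace V X := hc.chartedSpace hs
  refine isManifold_of_contDiffOn 𝓘(𝕜, V) n X ?_
  rintro _ _ ⟨q, rfl⟩ ⟨q', rfl⟩
  set e := (hc.localInverseAt (hs.hasRightInverse.choose q)).trans (chartAt V _) with he
  set e' := (hc.localInverseAt (hs.hasRightInverse.choose q')).trans (chartAt V _) with he'
  have hsymm : ∀ y, e.symm y = c y := fun y => by simp [he, chartAt_self_eq]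
  have happ : ∀ x ∈ e'.source, c (e' x) = x := by
    intro x hx
    have hx' : x ∈ (hc.localInverseAt (hs.hasRightInverse.choose q')).source := by
      simpa [he', chartAt_self_eq] using hx
    simpa [he', chartAt_self_eq] using hc.apply_localInverseAt_of_mem hx'
  set f := e.symm.trans e' with hf
  have hfc : ∀ y ∈ f.source, c (f y) = c y := by
    intro y hy
    have hy' : e.symm y ∈ e'.source := by
      have := hy
      rw [hf, OpenPartialHomeomorph.trans_source] at this
      exact this.2
    calc c (f y) = c (e' (e.symm y)) := rfl
      _ = e.symm y := happ _ hy'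
      _ = c y := hsymm y
  have key : ∀ y ∈ f.source, ContDiffAt 𝕜 n f y := by
    intro y hy
    have hinj : ∀ᶠ z in 𝓝 (0 : V), c z = 0 → z = 0 := by
      have hmem := (hc.localInverseAt (0 : V)).open_target.mem_nhds
        hc.self_mem_localInverseAt_target
      filter_upwards [hmem] with z hz h0
      exact hc.injOn_localInverseAt_target hz hc.self_mem_localInverseAt_target
        (by rw [h0, map_zero])
    have hcont : ContinuousAt (fun z => f z - z - (f y - y)) y :=
      ((f.continuousAt hy).sub continuousAt_id).sub continuousAt_const
    have hlim : Filter.Tendsto (fun z => f z - z - (f y - y)) (𝓝 y) (𝓝 0) := by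
      have := hcont.tendsto
      simpa using this
    have hev : f =ᶠ[𝓝 y] fun z => z + (f y - y) := by
      filter_upwards [hlim.eventually hinj, f.open_source.mem_nhds hy] with z hz hzs
      have : f z - z - (f y - y) = 0 := hz (by
        simp only [map_sub, hfc z hzs, hfc y hy, sub_self])
      rw [sub_eq_zero] at this
      rw [← this]
      abel
    exact (contDiffAt_id.add contDiffAt_const).congr_of_eventuallyEq hev
  intro y hy
  exact (key y hy.1).contDiffWithinAt

/-! ### Elliptic curves with a complexified Kähler class -/

/-- The form `dz ∧ dz̄` on `ℂ`. -/
def dzWedgeDzbar : ℂ [⋀^Fin 2]→L[ℝ] ℂ where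
  toFun m := m 0 * (starRingEnd ℂ) (m 1) - m 1 * (starRingEnd ℂ) (m 0)
  map_update_add' := by
    intro inst m i x y
    rw [Subsingleton.elim inst (instDecidableEqFin 2)]
    fin_cases i <;> simp <;> ring
  map_update_smul' := by
    intro inst m i c x
    rw [Subsingleton.elim inst (instDecidableEqFin 2)]
    fin_cases i <;> simp <;> ring
  cont := by fun_prop
  map_eq_zero_of_eq' := by
    intro m i j hij hne
    fin_cases i <;> fin_cases j <;> simp_all

/-- An elliptic curve `ℂ / Λ` with a complexified Kähler form `κ dz ∧ dz̄`.  Its real part is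
`2 Im(κ) dx ∧ dy`; the sign convention for Kähler forms is `g(a, b) = ω(i a, b)`, so that this is
a Kähler form if and only if `Im κ < 0`. -/
structure KahlerEllipticCurve where
  periods : PeriodPair
  κ : ℂ
  im_neg : κ.im < 0

namespace KahlerEllipticCurve

/-- The complex torus `ℂ / Λ`. -/
def Carrier (E : KahlerEllipticCurve) : Type := ℂ ⧸ E.periods.lattice.toAddSubgroup

instance (E : KahlerEllipticCurve) : AddCommGroup E.Carrier :=
  inferInstanceAs (AddCommGroup (ℂ ⧸ E.periods.lattice.toAddSubgroup))

instance (E : KahlerEllipticCurve) : TopologicalSpace E.Carrier :=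
  inferInstanceAs (TopologicalSpace (ℂ ⧸ E.periods.lattice.toAddSubgroup))

instance (E : KahlerEllipticCurve) : IsTopologicalAddGroup E.Carrier :=
  inferInstanceAs (IsTopologicalAddGroup (ℂ ⧸ E.periods.lattice.toAddSubgroup))

/-- The projection `ℂ → ℂ / Λ`. -/
def proj (E : KahlerEllipticCurve) : ℂ →+ E.Carrier :=
  QuotientAddGroup.mk' E.periods.lattice.toAddSubgroup

theorem proj_surjective (E : KahlerEllipticCurve) : Surjective E.proj :=
  QuotientAddGroup.mk'_surjective _

theorem isLocalHomeomorph_proj (E : KahlerEllipticCurve) : IsLocalHomeomorph E.proj := by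
  have h : IsDiscrete (E.periods.lattice.toAddSubgroup : Set ℂ) :=
    ⟨inferInstanceAs (DiscreteTopology E.periods.lattice)⟩
  exact (AddSubgroup.isAddQuotientCoveringMap_of_comm _ h).isCoveringMap.isLocalHomeomorph

theorem proj_eq_zero_iff (E : KahlerEllipticCurve) (z : ℂ) :
    E.proj z = 0 ↔ z ∈ E.periods.lattice :=
  QuotientAddGroup.eq_zero_iff z

/-- The charts of `ℂ / Λ` are the local inverses of the projection `ℂ → ℂ / Λ`.  All changes of
charts are translations, so that all tangent spaces of `ℂ / Λ` are identified with `ℂ`. -/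
instance (E : KahlerEllipticCurve) : ChartedSpace ℂ E.Carrier :=
  E.isLocalHomeomorph_proj.chartedSpace E.proj_surjective

instance (E : KahlerEllipticCurve) : IsManifold 𝓘(ℂ, ℂ) ω E.Carrier :=
  isManifold_of_addMonoidHom E.proj E.isLocalHomeomorph_proj E.proj_surjective ω

instance (E : KahlerEllipticCurve) : IsManifold 𝓘(ℝ, ℂ) ∞ E.Carrier :=
  isManifold_of_addMonoidHom E.proj E.isLocalHomeomorph_proj E.proj_surjective ∞

/-- The complexified Kähler form `κ dz ∧ dz̄`: a constant form on `ℂ`, i.e. an invariant form on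
`ℂ / Λ`, whose tangent spaces are identified with `ℂ`. -/
def form (E : KahlerEllipticCurve) : ℂ [⋀^Fin 2]→L[ℝ] ℂ := E.κ • dzWedgeDzbar

/-- The Kähler form on `ℂ / Λ`: the real part of the complexified Kähler form. -/
def kahlerForm (E : KahlerEllipticCurve) : TwoFormField ℂ E.Carrier := fun _ =>
  (Complex.reCLM.compContinuousAlternatingMap E.form : ℂ [⋀^Fin 2]→L[ℝ] ℝ)

/-- The Kähler metric `-2 Im(κ) (dx² + dy²)`. -/
def metric (E : KahlerEllipticCurve) (p : E.Carrier) :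
    TangentSpace 𝓘(ℝ, ℂ) p →L[ℝ] TangentSpace 𝓘(ℝ, ℂ) p →L[ℝ] ℝ :=
  ((-2 * E.κ.im) • innerSL ℝ : ℂ →L[ℝ] ℂ →L[ℝ] ℝ)

/-- The Kähler metric is `g(a, b) = ω(i a, b)` for the Kähler form `ω`. -/
theorem metric_eq (E : KahlerEllipticCurve) (p : E.Carrier) (a b : ℂ) :
    E.metric p a b = E.kahlerForm p ![Complex.I * a, b] := by
  change (-2 * E.κ.im) * inner ℝ a b = (E.κ * (Complex.I * a * (starRingEnd ℂ) b
    - b * (starRingEnd ℂ) (Complex.I * a))).re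
  simp [Complex.inner]
  ring

/-- The integral over `ℂ / Λ` of the complexified Kähler form: the form is invariant, and its
integral over a fundamental domain is the value on the frame `∂_x, ∂_y` times the area.  The
number determines the class of the form in `H²(ℂ / Λ, ℂ)`. -/
def integral (E : KahlerEllipticCurve) : ℂ :=
  E.form ![1, Complex.I] * (ZLattice.covolume E.periods.lattice : ℂ)

/-- Isomorphism of elliptic curves with complexified Kähler classes: a biholomorphic map which
takes one class into the other modulo `i H²(·, ℤ)`, i.e. the `B`-field (the imaginary part) counts
modulo integral classes. -/
def Iso (E E' : KahlerEllipticCurve) : Prop :=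
  Nonempty (Diffeomorph 𝓘(ℂ, ℂ) 𝓘(ℂ, ℂ) E.Carrier E'.Carrier ω) ∧
    ∃ k : ℤ, E'.integral - E.integral = (k : ℂ) * Complex.I

/-- The curve `E_τ = ℂ / (ℤ τ ⊕ ℤ)` with the complexified Kähler form
`-(t / (2 Im τ)) dz ∧ dz̄`. -/
def standard (τ t : UpperHalfPlane) : KahlerEllipticCurve where
  periods :=
    { ω₁ := τ
      ω₂ := 1
      indep := by
        rw [LinearIndependent.pair_iff]
        intro a b h
        have h1 := congrArg Complex.im h
        have h2 := congrArg Complex.re h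
        have hτ := τ.im_pos.ne'
        simp at h1 h2
        have ha : a = 0 := h1.resolve_right hτ
        subst ha
        simpa using h2 }
  κ := -(t : ℂ) / (2 * τ.im)
  im_neg := by
    have h1 := τ.im_pos
    have h2 := t.im_pos
    have : (-(t : ℂ) / (2 * τ.im)).im = -(t.im / (2 * τ.im)) := by
      have : (2 * τ.im : ℂ) = ((2 * τ.im : ℝ) : ℂ) := by push_cast; rfl
      rw [this, Complex.div_ofReal_im]
      simp [neg_div]
    rw [this]
    have : 0 < t.im / (2 * τ.im) := by positivity
    linarith

/-- `E₁, E₂` form a mirror pair. -/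
def IsMirrorPair (E₁ E₂ : KahlerEllipticCurve) : Prop :=
  ∃ τ t : UpperHalfPlane, E₁.Iso (standard τ t) ∧ E₂.Iso (standard t τ)

end KahlerEllipticCurve

/-! ### The base circle and the fibre product -/

namespace TwoFormsWithMetric

variable {V : Type*} [NormedAddCommGroup V] [NormedSpace ℝ V]
variable {X : Type*} [TopologicalSpace X] [ChartedSpace V X]

/-- `X →₁ E`: the elliptic curve with complexified Kähler class `E` is obtained from
`(X, ω₁, ω₂, g)`, `dim X = 3`, as follows.  As a smooth manifold, `E` is the quotient
`X / ω₁^⊥` with projection `π`; the Kähler form of `E` is the push-forward of `ω₁`, and the Kähler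
metric of `E` is the push-forward of `g`, so that `π` is a Riemannian submersion (these two
determine the complex structure of `E`).  The class of the `B`-field of `E` modulo integral classes
is the monodromy of the circle fibration `X / ω₂^⊥ → X / (ω₁^⊥ + ω₂^⊥)`. -/
def YieldsFirst (D : TwoFormsWithMetric V X) (E : KahlerEllipticCurve) : Prop :=
  (∃ π : X → E.Carrier,
    ContMDiff 𝓘(ℝ, V) 𝓘(ℝ, ℂ) ∞ π ∧ Surjective π ∧
    (∀ p, Surjective (mfderiv 𝓘(ℝ, V) 𝓘(ℝ, ℂ) π p)) ∧
    (∀ p q, π p = π q ↔ q ∈ (TwoFormField.perp D.ω₁).leaf p) ∧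
    (∀ (p : X) (u u' : TangentSpace 𝓘(ℝ, V) p), D.ω₁ p ![u, u'] = E.kahlerForm (π p)
      ![mfderiv 𝓘(ℝ, V) 𝓘(ℝ, ℂ) π p u, mfderiv 𝓘(ℝ, V) 𝓘(ℝ, ℂ) π p u']) ∧
    (∀ (p : X) (u u' : TangentSpace 𝓘(ℝ, V) p),
      (∀ x, mfderiv 𝓘(ℝ, V) 𝓘(ℝ, ℂ) π p x = 0 → D.g p u x = 0) →
      (∀ x, mfderiv 𝓘(ℝ, V) 𝓘(ℝ, ℂ) π p x = 0 → D.g p u' x = 0) →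
      D.g p u u' = E.metric (π p)
        (mfderiv 𝓘(ℝ, V) 𝓘(ℝ, ℂ) π p u) (mfderiv 𝓘(ℝ, V) 𝓘(ℝ, ℂ) π p u'))) ∧
  D.IsMonodromy E.integral.im

/-- `X →₂ E`: the same with the two forms exchanged, so that `E = X / ω₂^⊥`. -/
def YieldsSecond (D : TwoFormsWithMetric V X) (E : KahlerEllipticCurve) : Prop :=
  D.swap.YieldsFirst E

end TwoFormsWithMetric

theorem circle_coe_surjective : Surjective ((↑) : ℝ → UnitAddCircle) :=
  QuotientAddGroup.mk_surjective

/-- The circle `B = ℝ / ℤ`, as a manifold. -/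
instance : ChartedSpace ℝ UnitAddCircle :=
  (AddCircle.isLocalHomeomorph_coe (1 : ℝ)).chartedSpace circle_coe_surjective

namespace KahlerEllipticCurve

/-- The projection `E_τ → B`, `[z] ↦ [Im z / Im τ]`, induced by `Im : ℂ → ℝ`. -/
def toCircle (τ t : UpperHalfPlane) : (standard τ t).Carrier →+ UnitAddCircle :=
  QuotientAddGroup.lift _
    ((QuotientAddGroup.mk' (AddSubgroup.zmultiples (1 : ℝ))).comp
      ((AddMonoidHom.mulRight (τ.im⁻¹)).comp Complex.imAddGroupHom))
    (by
      intro z hz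
      obtain ⟨m, n, rfl⟩ := PeriodPair.mem_lattice.mp hz
      have hτ := τ.im_pos.ne'
      rw [AddMonoidHom.mem_ker]
      change ((_ : ℝ) : UnitAddCircle) = 0
      rw [AddCircle.coe_eq_zero_iff]
      exact ⟨m, by simp [standard, hτ]⟩)

theorem toCircle_proj (τ t : UpperHalfPlane) (z : ℂ) :
    toCircle τ t ((standard τ t).proj z) = ((z.im * τ.im⁻¹ : ℝ) : UnitAddCircle) := rfl

end KahlerEllipticCurve

open KahlerEllipticCurve

/-- The fibre product `E_τ ×_B E_t`. -/
def fibreProduct (τ t : UpperHalfPlane) :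
    AddSubgroup ((standard τ t).Carrier × (standard t τ).Carrier) where
  carrier := {x | toCircle τ t x.1 = toCircle t τ x.2}
  add_mem' := by
    intro a b ha hb
    simp only [mem_ofPred_eq] at ha hb ⊢
    simp [ha, hb]
  zero_mem' := by simp
  neg_mem' := by
    intro a ha
    simp only [mem_ofPred_eq] at ha ⊢
    simp [ha]

/-- The fibre product `T E_τ ×_{T B} T E_t` of the tangent spaces, inside `ℂ × ℂ`. -/
def fibreTangent (τ t : UpperHalfPlane) : Submodule ℝ (ℂ × ℂ) where
  carrier := {u | u.1.im * τ.im⁻¹ = u.2.im * t.im⁻¹}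
  add_mem' := by
    intro a b ha hb
    simp only [mem_ofPred_eq] at ha hb ⊢
    simp [add_mul, ha, hb]
  zero_mem' := by simp
  smul_mem' := by
    intro c a ha
    simp only [mem_ofPred_eq] at ha ⊢
    simp [mul_assoc, ha]

/-- The covering `(u, w) ↦ ([u], [w])` of the fibre product. -/
def fibreCover (τ t : UpperHalfPlane) : fibreTangent τ t →+ fibreProduct τ t where
  toFun u := ⟨((standard τ t).proj u.1.1, (standard t τ).proj u.1.2), by
    change toCircle τ t ((standard τ t).proj u.1.1) = toCircle t τ ((standard t τ).proj u.1.2)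
    rw [toCircle_proj, toCircle_proj, show _ = _ from u.2]⟩
  map_zero' := by ext <;> simp
  map_add' := by intro a b; ext <;> simp

theorem fibreCover_surjective (τ t : UpperHalfPlane) : Surjective (fibreCover τ t) := by
  rintro ⟨⟨p, q⟩, h⟩
  obtain ⟨u, rfl⟩ := proj_surjective _ p
  obtain ⟨w, rfl⟩ := proj_surjective _ q
  have h' : toCircle τ t ((standard τ t).proj u) = toCircle t τ ((standard t τ).proj w) := h
  rw [toCircle_proj, toCircle_proj, ← sub_eq_zero, ← AddCircle.coe_sub,
    AddCircle.coe_eq_zero_iff] at h'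
  obtain ⟨k, hk⟩ := h'
  have hper : (k : ℂ) * (t : ℂ) ∈ (standard t τ).periods.lattice :=
    PeriodPair.mem_lattice.mpr ⟨k, 0, by simp [standard]⟩
  refine ⟨⟨(u, w + k * t), ?_⟩, ?_⟩
  · have ht := t.im_pos.ne'
    change u.im * τ.im⁻¹ = (w + k * t).im * t.im⁻¹
    simp only [zsmul_eq_mul, mul_one] at hk
    simp [add_mul, ht]
    linarith
  · apply Subtype.ext
    refine Prod.ext rfl ?_
    change (standard t τ).proj (w + k * t) = (standard t τ).proj w
    rw [map_add, (proj_eq_zero_iff _ _).mpr hper, add_zero]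

theorem isLocalHomeomorph_fibreCover (τ t : UpperHalfPlane) :
    IsLocalHomeomorph (fibreCover τ t) := by
  have hc1 := (isLocalHomeomorph_proj (standard τ t))
  have hc2 := (isLocalHomeomorph_proj (standard t τ))
  have hcont : Continuous (fibreCover τ t) := by
    refine Continuous.subtype_mk (Continuous.prodMk ?_ ?_) _
    · exact hc1.continuous.comp (continuous_fst.comp continuous_subtype_val)
    · exact hc2.continuous.comp (continuous_snd.comp continuous_subtype_val)
  have hopen : IsOpenMap (fibreCover τ t) := by
    rw [IsTopologicalAddGroup.isOpenMap_iff_nhds_zero]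
    intro S hS
    rw [Filter.mem_map, nhds_subtype_eq_comap, Filter.mem_comap] at hS
    obtain ⟨T, hT, hTS⟩ := hS
    change T ∈ 𝓝 ((0 : ℂ), (0 : ℂ)) at hT
    rw [mem_nhds_prod_iff] at hT
    obtain ⟨T1, hT1, T2, hT2, hT12⟩ := hT
    have im1 : ∀ᶠ u : ℂ in 𝓝 0, |u.im * τ.im⁻¹| < 1 / 2 := by
      have : Continuous fun u : ℂ => |u.im * τ.im⁻¹| := by fun_prop
      exact this.continuousAt.eventually_lt_const (by simp)
    have im2 : ∀ᶠ w : ℂ in 𝓝 0, |w.im * t.im⁻¹| < 1 / 2 := by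
      have : Continuous fun w : ℂ => |w.im * t.im⁻¹| := by fun_prop
      exact this.continuousAt.eventually_lt_const (by simp)
    have h1 := hc1.isOpenMap.image_mem_nhds (Filter.inter_mem hT1 im1)
    have h2 := hc2.isOpenMap.image_mem_nhds (Filter.inter_mem hT2 im2)
    rw [map_zero] at h1 h2
    rw [nhds_subtype_eq_comap, Filter.mem_comap]
    refine ⟨_, prod_mem_nhds h1 h2, ?_⟩
    rintro ⟨⟨p, q⟩, hpq⟩ ⟨⟨u, ⟨hu1, hu2⟩, hu⟩, ⟨w, ⟨hw1, hw2⟩, hw⟩⟩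
    simp only at hu hw
    subst hu hw
    have hpq' : toCircle τ t ((standard τ t).proj u) = toCircle t τ ((standard t τ).proj w) := hpq
    rw [toCircle_proj, toCircle_proj, ← sub_eq_zero, ← AddCircle.coe_sub,
      AddCircle.coe_eq_zero_iff] at hpq'
    obtain ⟨k, hk⟩ := hpq'
    simp only [zsmul_eq_mul, mul_one] at hk
    have hu2' : |u.im * τ.im⁻¹| < 1 / 2 := hu2
    have hw2' : |w.im * t.im⁻¹| < 1 / 2 := hw2
    have hk0 : k = 0 := by
      rw [abs_lt] at hu2' hw2'
      have a1 : (k : ℝ) < 1 := by linarith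
      have a2 : (-1 : ℝ) < k := by linarith
      have b1 : k < 1 := by exact_mod_cast a1
      have b2 : -1 < k := by exact_mod_cast a2
      omega
    have hV : (u, w) ∈ fibreTangent τ t := by
      change u.im * τ.im⁻¹ = w.im * t.im⁻¹
      rw [hk0] at hk
      simp at hk
      linarith
    exact hTS (a := ⟨(u, w), hV⟩) (hT12 ⟨hu1, hw1⟩)
  have hdisc : IsDiscrete ((fibreCover τ t).ker : Set (fibreTangent τ t)) := by
    have hinj : ∀ E : KahlerEllipticCurve, ∀ᶠ z in 𝓝 (0 : ℂ), E.proj z = 0 → z = 0 := by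
      intro E
      have hE := E.isLocalHomeomorph_proj
      filter_upwards [(hE.localInverseAt (0 : ℂ)).open_target.mem_nhds
        hE.self_mem_localInverseAt_target] with z hz h0
      exact hE.injOn_localInverseAt_target hz hE.self_mem_localInverseAt_target
        (by rw [h0, map_zero])
    have l1 : Filter.Tendsto (fun v : (fibreCover τ t).ker => v.1.1.1) (𝓝 0) (𝓝 0) := by
      have : Continuous fun v : (fibreCover τ t).ker => v.1.1.1 := by fun_prop
      simpa using this.tendsto 0
    have l2 : Filter.Tendsto (fun v : (fibreCover τ t).ker => v.1.1.2) (𝓝 0) (𝓝 0) := by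
      have : Continuous fun v : (fibreCover τ t).ker => v.1.1.2 := by fun_prop
      simpa using this.tendsto 0
    have hev : ∀ᶠ v in 𝓝 (0 : (fibreCover τ t).ker), v = 0 := by
      filter_upwards [l1.eventually (hinj (standard τ t)), l2.eventually (hinj (standard t τ))]
        with v h1 h2
      have hv : fibreCover τ t v.1 = 0 := v.2
      have hv' := congrArg Subtype.val hv
      exact Subtype.ext (Subtype.ext (Prod.ext (h1 (congrArg Prod.fst hv'))
        (h2 (congrArg Prod.snd hv'))))
    have hopen0 : IsOpen ({0} : Set (fibreCover τ t).ker) :=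
      by
      rw [isOpen_iff_mem_nhds]
      rintro _ rfl
      filter_upwards [hev] with v hv using hv
    exact ⟨discreteTopology_of_isOpen_singleton_zero hopen0⟩
  exact ((hopen.isQuotientMap hcont
    (fibreCover_surjective τ t)).isAddQuotientCoveringMap_of_isDiscrete_ker_addMonoidHom
      hdisc).isCoveringMap.isLocalHomeomorph

/-- The charts of the fibre product are the local inverses of the covering by `fibreTangent`, so
that all its tangent spaces are identified with `T E_τ ×_{T B} T E_t`. -/
instance (τ t : UpperHalfPlane) : ChartedSpace (fibreTangent τ t) (fibreProduct τ t) :=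
  (isLocalHomeomorph_fibreCover τ t).chartedSpace (fibreCover_surjective τ t)

instance (τ t : UpperHalfPlane) : IsManifold 𝓘(ℝ, fibreTangent τ t) ∞ (fibreProduct τ t) :=
  isManifold_of_addMonoidHom (fibreCover τ t) (isLocalHomeomorph_fibreCover τ t)
    (fibreCover_surjective τ t) ∞

/-- The pull-back of a bilinear form. -/
def pullbackBilin {V W : Type*} [NormedAddCommGroup V] [NormedSpace ℝ V]
    [NormedAddCommGroup W] [NormedSpace ℝ W] (B : W →L[ℝ] W →L[ℝ] ℝ) (A : V →L[ℝ] W) :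
    V →L[ℝ] V →L[ℝ] ℝ :=
  B.bilinearComp A A

section Mirror

variable (τ t : UpperHalfPlane)

/-- The projection `π₁ : E_τ ×_B E_t → E_τ`. -/
def fibreFst (x : fibreProduct τ t) : (standard τ t).Carrier := x.1.1

/-- The projection `π₂ : E_τ ×_B E_t → E_t`. -/
def fibreSnd (x : fibreProduct τ t) : (standard t τ).Carrier := x.1.2

/-- The projection `π_B : E_τ ×_B E_t → B`. -/
def fibreBase (x : fibreProduct τ t) : UnitAddCircle := toCircle τ t x.1.1

/-- The manifold `X_{τ,t} = E_τ ×_B E_t` with its forms and its metric.  The curves `E_τ`, `E_t`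
carry the Kähler structures of `standard τ t`, `standard t τ`, i.e. the Kähler forms
`-i (Im t / (2 Im τ)) dz ∧ dz̄` and `-i (Im τ / (2 Im t)) dz ∧ dz̄`.  The forms `ω₁, ω₂` are the
pull-backs of the Kähler forms.  The metric `g` is obtained from the restriction
`π₁^* g_{E_τ} + π₂^* g_{E_t}` of the product metric by halving the squared lengths of the vectors
orthogonal to the fibres of `π_B` and changing nothing along these fibres.  The projections of the
curves to `B` are Riemannian for `g_B = Im τ Im t ds²`, so the square of the length of a
vector orthogonal to the fibres is twice its square for `π_B^* g_B`: halving amounts to subtracting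
`π_B^* g_B`, and `g = π₁^* g_{E_τ} + π₂^* g_{E_t} - π_B^* g_B`. -/
def mirrorManifold : TwoFormsWithMetric (fibreTangent τ t) (fibreProduct τ t) where
  ω₁ := fun p => ((standard τ t).kahlerForm (fibreFst τ t p)).compContinuousLinearMap
    (mfderiv 𝓘(ℝ, fibreTangent τ t) 𝓘(ℝ, ℂ) (fibreFst τ t) p)
  ω₂ := fun p => ((standard t τ).kahlerForm (fibreSnd τ t p)).compContinuousLinearMap
    (mfderiv 𝓘(ℝ, fibreTangent τ t) 𝓘(ℝ, ℂ) (fibreSnd τ t) p)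
  g := fun p =>
    (pullbackBilin (V := fibreTangent τ t) (W := ℂ) ((standard τ t).metric (fibreFst τ t p))
        (mfderiv 𝓘(ℝ, fibreTangent τ t) 𝓘(ℝ, ℂ) (fibreFst τ t) p)
      + pullbackBilin (V := fibreTangent τ t) (W := ℂ) ((standard t τ).metric (fibreSnd τ t p))
        (mfderiv 𝓘(ℝ, fibreTangent τ t) 𝓘(ℝ, ℂ) (fibreSnd τ t) p)
      - pullbackBilin (V := fibreTangent τ t) (W := ℝ) ((τ.im * t.im) • innerSL ℝ)
        (mfderiv 𝓘(ℝ, fibreTangent τ t) 𝓘(ℝ, ℝ) (fibreBase τ t) p) :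
      fibreTangent τ t →L[ℝ] fibreTangent τ t →L[ℝ] ℝ)

end Mirror

end

noncomputable section

/-! ### Coverings by translations -/

/-! Everything becomes linear algebra on the covering of the fibre product by `fibreTangent`. This
space has real coordinates (s, x, y), a point being the pair (x + i s Im τ, y + i s Im t). The deck
group consists of the translations by (m, m Re τ + n, m Re t + k) with integers m, n, k
(`fibreCover_eq_iff`). In these coordinates all data are constant: ω₁ = Im t ds ∧ dx, ω₂ = Im τ ds ∧
dy, and g = (Im t / Im τ) dx² + (Im τ / Im t) dy² + Im τ Im t ds².

Self-duality can be read off. An adapted basis is h ∂_s, h Im τ ∂_x, h Im t ∂_y with h² Im τ Im t =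
1, so it is unique up to the sign of h. The dualizing form is dx ∧ dy. A leaf of ω₁^⊥ + ω₂^⊥ is a
unit square with opposite sides identified, and its volume density is 1.

The line ω₁^⊥ is spanned by ∂_y, so forgetting y gives E_τ with its Kähler form and metric. The deck
transformation with m = 1 shears y by Re t; this shear is the monodromy of X / ω₂^⊥ over the base
(`isMonodromy_iff`), and it equals the integral of the B-field of `standard τ t`.

Conversely, let π present some curve E as X / ω₁^⊥. Restricting π to the slice y = 0 and lifting to
the universal covers gives F : ℂ → ℂ, which scales area form and metric by one positive constant.
Hence F is holomorphic with |F'| constant, affine by Liouville, and its slope a carries one lattice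
onto the other (`exists_isSimilarity_of_yieldsFirst`). By `iso_iff` such a similarity, together with
the B-field modulo integers, is the same as an isomorphism of curves with complexified Kähler class.

The relation with the two forms exchanged reduces to this one, because exchanging the factors
identifies X_{τ,t} with X_{t,τ}. All relations are invariant under isomorphism, and the mirror
statement then holds with the same τ, t on both sides. -/

/-- The charts of `X` are local inverses of the covering homomorphism `c` from a normed space. -/
structure IsTranslationCover {V X : Type*} [NormedAddCommGroup V] [TopologicalSpace X]
    [AddCommGroup X] [ChartedSpace V X] (c : V →+ X) : Prop where
  isLocalHomeomorph : IsLocalHomeomorph c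
  surjective : Surjective c
  symm_eq : ∀ e ∈ atlas V X, ⇑e.symm = c

theorem isTranslationCover_chartedSpace {V X : Type*} [NormedAddCommGroup V] [TopologicalSpace X]
    [AddCommGroup X] (c : V →+ X) (hc : IsLocalHomeomorph c) (hs : Surjective c) :
    @IsTranslationCover V X _ _ _ (hc.chartedSpace hs) c := by
  let _ : ChartedSpace V X := hc.chartedSpace hs
  refine ⟨hc, hs, ?_⟩
  rintro _ ⟨q, rfl⟩
  funext y
  simp [chartAt_self_eq]

namespace IsTranslationCover

/-! ### Charts as local inverses of the covering. -/

section Charts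

variable {𝕜 : Type*} [NontriviallyNormedField 𝕜]
variable {V : Type*} [NormedAddCommGroup V] [NormedSpace 𝕜 V]
variable {X : Type*} [TopologicalSpace X] [AddCommGroup X] [ChartedSpace V X]
variable {c : V →+ X}

theorem eventually_eq_zero (hc : IsTranslationCover c) : ∀ᶠ z in 𝓝 (0 : V), c z = 0 → z = 0 := by
  have h := hc.isLocalHomeomorph
  filter_upwards [(h.localInverseAt (0 : V)).open_target.mem_nhds
    h.self_mem_localInverseAt_target] with z hz h0
  exact h.injOn_localInverseAt_target hz h.self_mem_localInverseAt_target (by rw [h0, map_zero])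

/-- Two continuous maps with the same image in `X` differ by a locally constant map. -/
theorem eventually_sub_eq (hc : IsTranslationCover c) {A : Type*} [TopologicalSpace A] {f g : A → V}
    {a : A} (hf : ContinuousAt f a) (hg : ContinuousAt g a) (h : ∀ᶠ x in 𝓝 a, c (f x) = c (g x)) :
    ∀ᶠ x in 𝓝 a, f x = g x + (f a - g a) := by
  -- After subtraction of its value at `a` the difference tends to 0; it also lies in the kernel of
  -- `c`, in which 0 is isolated.
  have hlim : Filter.Tendsto (fun x => f x - g x - (f a - g a)) (𝓝 a) (𝓝 0) := by
    have := ((hf.sub hg).sub (continuousAt_const (y := f a - g a))).tendsto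
    rwa [Pi.sub_apply, Pi.sub_apply, sub_self] at this
  have ha := h.self_of_nhds
  filter_upwards [hlim.eventually hc.eventually_eq_zero, h] with x hx hx'
  have h0 := hx (by simp [hx', ha])
  rw [sub_eq_zero] at h0
  rw [← h0]
  abel

theorem apply_chart (hc : IsTranslationCover c) {e : OpenPartialHomeomorph X V}
    (he : e ∈ atlas V X) {x : X} (hx : x ∈ e.source) : c (e x) = x := by
  rw [← hc.symm_eq e he, e.left_inv hx]

/-- In the charts the covering map is a translation. -/
theorem chart_comp_eventuallyEq (hc : IsTranslationCover c) {e : OpenPartialHomeomorph X V}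
    (he : e ∈ atlas V X) {v : V} (hv : c v ∈ e.source) :
    (fun z => e (c z)) =ᶠ[𝓝 v] fun z => z + (e (c v) - v) := by
  have hcont := hc.isLocalHomeomorph.continuous
  refine hc.eventually_sub_eq (f := fun z => e (c z)) (g := id) ?_ continuousAt_id ?_
  · exact ContinuousAt.comp (g := e) (f := c) (e.continuousAt hv) hcont.continuousAt
  · filter_upwards [hcont.continuousAt.preimage_mem_nhds (e.open_source.mem_nhds hv)] with z hz
    exact hc.apply_chart he hz

theorem contMDiff (hc : IsTranslationCover c) {n : WithTop ℕ∞} :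
    ContMDiff 𝓘(𝕜, V) 𝓘(𝕜, V) n c := by
  intro v
  rw [contMDiffAt_iff]
  refine ⟨hc.isLocalHomeomorph.continuous.continuousAt, ?_⟩
  have h := hc.chart_comp_eventuallyEq (chart_mem_atlas V (c v)) (mem_chart_source V (c v))
  have h2 : ContDiffAt 𝕜 n (fun z => z + (chartAt V (c v) (c v) - v)) v :=
    contDiffAt_id.add contDiffAt_const
  have h3 := h2.congr_of_eventuallyEq h
  simpa [Function.comp_def] using! h3.contDiffWithinAt (s := univ)

/-- Tangent spaces of `X` are read in the preferred charts, where `c` is a translation; this makes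
the identification of every tangent space with `V` canonical. -/
theorem hasMFDerivAt (hc : IsTranslationCover c) (v : V) :
    HasMFDerivAt 𝓘(𝕜, V) 𝓘(𝕜, V) c v (ContinuousLinearMap.id 𝕜 V) := by
  refine ⟨hc.isLocalHomeomorph.continuous.continuousAt, ?_⟩
  have h := hc.chart_comp_eventuallyEq (chart_mem_atlas V (c v)) (mem_chart_source V (c v))
  have h2 : HasFDerivAt (fun z => z + (chartAt V (c v) (c v) - v))
      (ContinuousLinearMap.id 𝕜 V) v := (hasFDerivAt_id v).add_const _
  have h3 := h2.congr_of_eventuallyEq h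
  have h4 := h3.hasFDerivWithinAt (s := univ)
  simpa [writtenInExtChartAt, Function.comp_def, chartAt_self_eq, -hasFDerivWithinAt_univ]
    using! h4

theorem mfderiv_eq (hc : IsTranslationCover c) (v : V) :
    mfderiv 𝓘(𝕜, V) 𝓘(𝕜, V) c v = ContinuousLinearMap.id 𝕜 V :=
  (hc.hasMFDerivAt v).mfderiv

/-- Every chart has the identity as derivative. -/
theorem hasMFDerivAt_chart (hc : IsTranslationCover c) {e : OpenPartialHomeomorph X V}
    (he : e ∈ atlas V X) {x : X} (hx : x ∈ e.source) :
    HasMFDerivAt 𝓘(𝕜, V) 𝓘(𝕜, V) e x (ContinuousLinearMap.id 𝕜 V) := by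
  refine ⟨e.continuousAt hx, ?_⟩
  have hy : c (chartAt V x x) = x := hc.apply_chart (chart_mem_atlas V x) (mem_chart_source V x)
  have h := hc.chart_comp_eventuallyEq he (v := chartAt V x x) (by rwa [hy])
  have h2 : HasFDerivAt (fun z => z + (e (c (chartAt V x x)) - chartAt V x x))
      (ContinuousLinearMap.id 𝕜 V) (chartAt V x x) := (hasFDerivAt_id _).add_const _
  have h3 := h2.congr_of_eventuallyEq h
  have h4 := h3.hasFDerivWithinAt (s := univ)
  rw [← hc.symm_eq _ (chart_mem_atlas V x)] at h4
  simpa [writtenInExtChartAt, Function.comp_def, chartAt_self_eq, -hasFDerivWithinAt_univ]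
    using! h4

theorem mfderiv_chart (hc : IsTranslationCover c) {e : OpenPartialHomeomorph X V}
    (he : e ∈ atlas V X) {x : X} (hx : x ∈ e.source) :
    mfderiv 𝓘(𝕜, V) 𝓘(𝕜, V) e x = ContinuousLinearMap.id 𝕜 V :=
  (hc.hasMFDerivAt_chart he hx).mfderiv

/-- Near every point a map on `X` is a map on `V` followed by a chart. -/
theorem eventuallyEq_comp_chart (hc : IsTranslationCover c) {Y : Type*} (g : X → Y) (x : X) :
    g =ᶠ[𝓝 x] fun y => (g ∘ c) (chartAt V x y) := by
  filter_upwards [chart_source_mem_nhds V x] with y hy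
  simp [hc.apply_chart (chart_mem_atlas V x) hy]

section Maps

variable {W : Type*} [NormedAddCommGroup W] [NormedSpace 𝕜 W]
variable {Y : Type*} [TopologicalSpace Y] [ChartedSpace W Y]

/-- Charts are local sections of `c`, so locally `g` is `g ∘ c` after a smooth chart. Smoothness
and, in `hasMFDerivAt_of_comp`, derivatives on a quotient are thus checked on the vector space. -/
theorem contMDiff_iff (hc : IsTranslationCover c) {n : WithTop ℕ∞} [IsManifold 𝓘(𝕜, V) n X]
    {g : X → Y} :
    ContMDiff 𝓘(𝕜, V) 𝓘(𝕜, W) n g ↔ ContMDiff 𝓘(𝕜, V) 𝓘(𝕜, W) n (g ∘ c) := by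
  refine ⟨fun h => h.comp hc.contMDiff, fun h x => ?_⟩
  have h1 : ContMDiffAt 𝓘(𝕜, V) 𝓘(𝕜, V) n (chartAt V x) x :=
    contMDiffAt_of_mem_maximalAtlas (IsManifold.chart_mem_maximalAtlas x) (mem_chart_source V x)
  exact (ContMDiffAt.comp x h.contMDiffAt h1).congr_of_eventuallyEq
    (hc.eventuallyEq_comp_chart g x)

theorem hasMFDerivAt_of_comp (hc : IsTranslationCover c) {g : X → Y} {x : X}
    {A : V →L[𝕜] W}
    (h : ∀ v, c v = x → HasMFDerivAt 𝓘(𝕜, V) 𝓘(𝕜, W) (g ∘ c) v A) :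
    HasMFDerivAt 𝓘(𝕜, V) 𝓘(𝕜, W) g x A := by
  have h1 := hc.hasMFDerivAt_chart (𝕜 := 𝕜) (chart_mem_atlas V x) (mem_chart_source V x)
  have h2 := h (chartAt V x x) (hc.apply_chart (chart_mem_atlas V x) (mem_chart_source V x))
  have h3 := (h2.comp x h1).congr_of_eventuallyEq (hc.eventuallyEq_comp_chart g x)
  simpa using! h3

/-- A continuous lift of a smooth map is smooth. -/
theorem contMDiff_of_lift (hc : IsTranslationCover c) {n : WithTop ℕ∞} [IsManifold 𝓘(𝕜, V) n X]
    {F : Y → V} (hF : Continuous F) (h : ContMDiff 𝓘(𝕜, W) 𝓘(𝕜, V) n (fun y => c (F y))) :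
    ContMDiff 𝓘(𝕜, W) 𝓘(𝕜, V) n F := by
  intro y
  set e := chartAt V (c (F y)) with he
  have h1 : ContMDiffAt 𝓘(𝕜, V) 𝓘(𝕜, V) n e (c (F y)) :=
    contMDiffAt_of_mem_maximalAtlas (IsManifold.chart_mem_maximalAtlas _) (mem_chart_source V _)
  have h2 : ContMDiffAt 𝓘(𝕜, W) 𝓘(𝕜, V) n (fun z => e (c (F z))) y :=
    ContMDiffAt.comp y h1 h.contMDiffAt
  have h3 := hc.chart_comp_eventuallyEq (chart_mem_atlas V _) (mem_chart_source V (c (F y)))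
  have h4 := hF.continuousAt.eventually h3
  have h5 : ContMDiffAt 𝓘(𝕜, W) 𝓘(𝕜, V) n
      (fun z => e (c (F z)) + (F y - e (c (F y)))) y := h2.add contMDiffAt_const
  refine h5.congr_of_eventuallyEq ?_
  filter_upwards [h4] with z hz
  rw [hz]
  abel

theorem mfderiv_comp_lift (hc : IsTranslationCover c) {F : Y → V} {y : Y}
    (hF : MDifferentiableAt 𝓘(𝕜, W) 𝓘(𝕜, V) F y) :
    mfderiv 𝓘(𝕜, W) 𝓘(𝕜, V) (fun z => c (F z)) y = mfderiv 𝓘(𝕜, W) 𝓘(𝕜, V) F y := by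
  have := ((hc.hasMFDerivAt (𝕜 := 𝕜) (F y)).comp y hF.hasMFDerivAt).mfderiv
  simpa [Function.comp_def] using! this

end Maps

end Charts

/-! ### Lifting maps through the covering. -/

section Lifts

variable {V : Type*} [NormedAddCommGroup V]
variable {X : Type*} [TopologicalSpace X] [AddCommGroup X] [ChartedSpace V X]
variable {c : V →+ X}

/-- A local homeomorphism need not lift paths. Here `c` is moreover an open quotient homomorphism
with discrete kernel, hence the quotient by a group of translations acting as deck transformations.
-/
theorem isCoveringMap (hc : IsTranslationCover c) : IsCoveringMap c := by
  have hdisc : IsDiscrete (c.ker : Set V) := by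
    have l1 : Filter.Tendsto (fun v : c.ker => (v : V)) (𝓝 0) (𝓝 0) := by
      have : Continuous fun v : c.ker => (v : V) := by fun_prop
      simpa using this.tendsto 0
    refine ⟨discreteTopology_of_isOpen_singleton_zero ?_⟩
    rw [isOpen_iff_mem_nhds]
    rintro _ rfl
    filter_upwards [l1.eventually hc.eventually_eq_zero] with v hv
    exact Subtype.ext (hv v.2)
  have hq : Topology.IsQuotientMap c :=
    hc.isLocalHomeomorph.isOpenMap.isQuotientMap hc.isLocalHomeomorph.continuous hc.surjective
  exact (hq.isAddQuotientCoveringMap_of_isDiscrete_ker_addMonoidHom hdisc).isCoveringMap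

/-- A real normed space is simply connected and locally path connected, so every continuous map from
it lifts. -/
theorem exists_lift (hc : IsTranslationCover c) {W : Type*} [NormedAddCommGroup W]
    [NormedSpace ℝ W] {f : W → X} (hf : Continuous f) (w : W) {v : V} (hv : c v = f w) :
    ∃ F : W → V, Continuous F ∧ F w = v ∧ ∀ x, c (F x) = f x := by
  obtain ⟨F, ⟨h0, h1⟩, -⟩ := hc.isCoveringMap.existsUnique_continuousMap_lifts ⟨f, hf⟩ w v hv
  exact ⟨F, F.continuous, h0, fun x => congrFun h1 x⟩

end Lifts

/-! ### Curves, leaves and constant tensors on a quotient by translations. -/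

section Real

variable {V : Type*} [NormedAddCommGroup V] [NormedSpace ℝ V]
variable {X : Type*} [TopologicalSpace X] [AddCommGroup X] [ChartedSpace V X]
variable {c : V →+ X}

theorem velocity_eq (hc : IsTranslationCover c) {Γ : ℝ → V} (hΓ : Differentiable ℝ Γ) (s : ℝ) :
    velocity (V := V) (fun s => c (Γ s)) s = deriv Γ s := by
  unfold velocity
  rw [hc.mfderiv_comp_lift (hΓ s).mdifferentiableAt, mfderiv_eq_fderiv]
  rfl

/-- A smooth curve lifts to a smooth curve with the same velocity. -/
theorem exists_lift_curve (hc : IsTranslationCover c) [IsManifold 𝓘(ℝ, V) ∞ X] {γ : ℝ → X}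
    (hγ : ContMDiff 𝓘(ℝ, ℝ) 𝓘(ℝ, V) ∞ γ) {v : V} (hv : c v = γ 0) :
    ∃ Γ : ℝ → V, ContDiff ℝ ∞ Γ ∧ Γ 0 = v ∧ (∀ s, c (Γ s) = γ s) ∧
      ∀ s, velocity (V := V) γ s = deriv Γ s := by
  obtain ⟨Γ, h1, h2, h3⟩ := hc.exists_lift hγ.continuous 0 hv
  have h4 : γ = fun s => c (Γ s) := funext fun s => (h3 s).symm
  subst h4
  have h5 := (hc.contMDiff_of_lift h1 hγ).contDiff
  exact ⟨Γ, h5, h2, fun _ => rfl, hc.velocity_eq (h5.differentiable (by simp))⟩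

theorem contMDiff_curve (hc : IsTranslationCover c) {Γ : ℝ → V} (hΓ : ContDiff ℝ ∞ Γ) :
    ContMDiff 𝓘(ℝ, ℝ) 𝓘(ℝ, V) ∞ (fun s => c (Γ s)) :=
  hc.contMDiff.comp hΓ.contMDiff

/-- The leaves of the distribution given by the kernel of a linear map. -/
theorem mem_leaf_iff (hc : IsTranslationCover c) [IsManifold 𝓘(ℝ, V) ∞ X]
    {D : TangentDistribution V X} {W : Type*} [NormedAddCommGroup W] [NormedSpace ℝ W]
    (ℓ : V →L[ℝ] W) (hD : ∀ (p : X) (u : V), u ∈ D p ↔ ℓ u = 0) (v v' : V) :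
    c v' ∈ D.leaf (c v) ↔ ∃ w, c w = c v' ∧ ℓ w = ℓ v := by
  constructor
  · rintro ⟨γ, hγ, hvel, h0, h1⟩
    obtain ⟨Γ, hs, hΓ0, hΓ, hd⟩ := hc.exists_lift_curve hγ h0.symm
    refine ⟨Γ 1, by rw [hΓ, h1], ?_⟩
    have hdiff : Differentiable ℝ Γ := hs.differentiable (by simp)
    -- The lift `Γ` is tangent to the kernel of `ℓ`, so `ℓ` is constant along it and `Γ 1` is the
    -- required point over `c v'`.
    have hder : ∀ s, HasDerivAt (fun s => ℓ (Γ s)) 0 s := by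
      intro s
      have h2 := ℓ.hasFDerivAt.comp_hasDerivAt s (hdiff s).hasDerivAt
      have h3 : ℓ (deriv Γ s) = 0 := by
        rw [← hD (γ s), ← hd s]
        exact hvel s
      rwa [h3] at h2
    have := is_const_of_deriv_eq_zero (fun s => (hder s).differentiableAt)
      (fun s => (hder s).deriv) 1 0
    rw [this, hΓ0]
  · rintro ⟨w, hw, hl⟩
    -- The segment from `v` to `w` stays in a coset of the kernel of `ℓ`, so its image is a curve
    -- inside the leaf.
    have hs : ContDiff ℝ ∞ (fun s : ℝ => v + s • (w - v)) := by fun_prop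
    refine ⟨fun s => c (v + s • (w - v)), hc.contMDiff_curve hs, fun s => ?_, by simp, by simp [hw]⟩
    rw [hc.velocity_eq (hs.differentiable (by simp)) s]
    have hder : HasDerivAt (fun s : ℝ => v + s • (w - v)) ((1 : ℝ) • (w - v)) s :=
      ((hasDerivAt_id s).smul_const (w - v)).const_add v
    rw [hder.deriv]
    exact (hD _ _).2 (by simp [hl])

/-- The inverse of a chart is `c`, whose derivative is the identity; a constant form therefore has
constant coefficients in every chart, which makes it smooth and closed. -/
theorem inChart_const (hc : IsTranslationCover c) {η : TwoFormField V X}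
    {η₀ : V [⋀^Fin 2]→L[ℝ] ℝ} (hη : ∀ p, η p = η₀) {e : OpenPartialHomeomorph X V}
    (he : e ∈ atlas V X) : η.inChart e = fun _ => η₀ := by
  funext y
  unfold TwoFormField.inChart
  rw [hη, hc.symm_eq e he, hc.mfderiv_eq]
  ext u
  rfl

theorem isSmooth_const (hc : IsTranslationCover c) {η : TwoFormField V X}
    {η₀ : V [⋀^Fin 2]→L[ℝ] ℝ} (hη : ∀ p, η p = η₀) : η.IsSmooth := by
  intro e he
  rw [hc.inChart_const hη he]
  exact contDiffOn_const

theorem isClosed_const (hc : IsTranslationCover c) {η : TwoFormField V X}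
    {η₀ : V [⋀^Fin 2]→L[ℝ] ℝ} (hη : ∀ p, η p = η₀) : η.IsClosed := by
  intro e he y _
  rw [hc.inChart_const hη he]
  simp only [extDeriv, fderiv_const_apply]
  ext v
  simp [ContinuousAlternatingMap.alternatizeUncurryFin_apply]

theorem isIntegrable_const (hc : IsTranslationCover c) [IsManifold 𝓘(ℝ, V) ∞ X]
    {D : TangentDistribution V X} {F : Submodule ℝ V} (hD : ∀ (p : X), D p = F) :
    D.IsIntegrable := by
  intro p
  refine ⟨chartAt V p, IsManifold.chart_mem_maximalAtlas p, mem_chart_source V p, F, ?_⟩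
  intro q hq
  rw [hc.mfderiv_chart (chart_mem_atlas V p) hq, hD]
  exact Submodule.map_id F

/-- Changes of charts are translations. This makes a constant bilinear form a smooth section of the
bundle of bilinear forms. -/
theorem tangentCoordChange_eq (hc : IsTranslationCover c) [IsManifold 𝓘(ℝ, V) 1 X] {x y : X}
    (hy : y ∈ (chartAt V x).source) :
    tangentCoordChange 𝓘(ℝ, V) x y y = ContinuousLinearMap.id ℝ V := by
  have h := hc.chart_comp_eventuallyEq (chart_mem_atlas V y) (v := chartAt V x y)
    (by rw [hc.apply_chart (chart_mem_atlas V x) hy]; exact mem_chart_source V y)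
  have h2 : HasFDerivAt (fun z => z + (chartAt V y (c (chartAt V x y)) - chartAt V x y))
      (ContinuousLinearMap.id ℝ V) (chartAt V x y) := (hasFDerivAt_id _).add_const _
  have h3 := (h2.congr_of_eventuallyEq h).hasFDerivWithinAt (s := univ)
  rw [← hc.symm_eq _ (chart_mem_atlas V x)] at h3
  have h4 := h3.fderivWithin (by simp)
  rw [tangentCoordChange_def]
  simpa [Function.comp_def, -fderivWithin_univ] using h4

/-- A constant inner product is a smooth Riemannian metric. -/
theorem contMDiff_const_bilin (hc : IsTranslationCover c) [IsManifold 𝓘(ℝ, V) ∞ X]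
    (B : V →L[ℝ] V →L[ℝ] ℝ)
    (G : (p : X) → TangentSpace 𝓘(ℝ, V) p →L[ℝ] TangentSpace 𝓘(ℝ, V) p →L[ℝ] ℝ)
    (hG : ∀ p, G p = B) :
    ContMDiff 𝓘(ℝ, V) (𝓘(ℝ, V).prod 𝓘(ℝ, V →L[ℝ] V →L[ℝ] ℝ)) ∞
      (fun p : X => Bundle.TotalSpace.mk' (V →L[ℝ] V →L[ℝ] ℝ)
        (E := fun p : X => TangentSpace 𝓘(ℝ, V) p →L[ℝ] TangentSpace 𝓘(ℝ, V) p →L[ℝ] ℝ)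
        p (G p)) := by
  intro x
  rw [Bundle.contMDiffAt_section]
  refine (contMDiffAt_const (c := B)).congr_of_eventuallyEq ?_
  -- In the trivialization at `x` the section is `B` with both arguments moved by tangent coordinate
  -- changes, and these are identities.
  filter_upwards [chart_source_mem_nhds V x] with y hy
  ext v w
  have h1 := TangentBundle.symmL_trivializationAt_eq_core (I := 𝓘(ℝ, V)) hy
  have h2 : (tangentBundleCore 𝓘(ℝ, V) X).coordChange (achart V x) (achart V y) y
      = ContinuousLinearMap.id ℝ V := hc.tangentCoordChange_eq hy
  have hy' : y ∈ (trivializationAt (V →L[ℝ] ℝ)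
      (fun x : X => TangentSpace 𝓘(ℝ, V) x →L[ℝ] ℝ) x).baseSet := by
    simpa [hom_trivializationAt_baseSet] using hy
  have h3 : ∀ u : V, (trivializationAt V (TangentSpace 𝓘(ℝ, V)) x).symmL ℝ y u = u := by
    intro u
    rw [h1, h2]
    rfl
  simp only [hom_trivializationAt_apply, ContinuousLinearMap.inCoordinates, hG]
  simp only [ContinuousLinearMap.comp_apply, Bundle.Trivialization.continuousLinearMapAt_apply,
    Bundle.Trivialization.coe_linearMapAt_of_mem _ hy']
  simp only [hom_trivializationAt_apply, ContinuousLinearMap.inCoordinates]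
  simp only [Bundle.Trivial.fiberBundle_trivializationAt',
    Bundle.Trivial.continuousLinearMapAt_trivialization, ContinuousLinearMap.id_comp]
  change B ((trivializationAt V (TangentSpace 𝓘(ℝ, V)) x).symmL ℝ y v)
    ((trivializationAt V (TangentSpace 𝓘(ℝ, V)) x).symmL ℝ y w) = B v w
  rw [h3, h3]

end Real

end IsTranslationCover

/-! ### Isomorphisms of elliptic curves -/

namespace KahlerEllipticCurve

theorem isTranslationCover (E : KahlerEllipticCurve) : IsTranslationCover E.proj :=
  isTranslationCover_chartedSpace E.proj E.isLocalHomeomorph_proj E.proj_surjective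

theorem proj_eq_iff (E : KahlerEllipticCurve) (z w : ℂ) :
    E.proj z = E.proj w ↔ z - w ∈ E.periods.lattice := by
  rw [← sub_eq_zero, ← map_sub, proj_eq_zero_iff]

instance (E : KahlerEllipticCurve) : T2Space E.Carrier := by
  have : IsClosed (E.periods.lattice.toAddSubgroup : Set ℂ) := E.periods.isClosed_lattice
  exact inferInstanceAs (T2Space (ℂ ⧸ E.periods.lattice.toAddSubgroup))

instance (E : KahlerEllipticCurve) : SecondCountableTopology E.Carrier :=
  inferInstanceAs (SecondCountableTopology (ℂ ⧸ E.periods.lattice.toAddSubgroup))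

/-- On the frame 1, i the form dz ∧ dz̄ has the value -2i, so the Kähler class is governed by Im κ
and the B-field by Re κ. -/
theorem integral_re (E : KahlerEllipticCurve) :
    E.integral.re = 2 * E.κ.im * ZLattice.covolume E.periods.lattice := by
  have : E.form ![1, Complex.I] = E.κ * (1 * (starRingEnd ℂ) Complex.I
    - Complex.I * (starRingEnd ℂ) 1) := rfl
  rw [integral, this, Complex.re_mul_ofReal]
  simp
  ring

theorem integral_im (E : KahlerEllipticCurve) :
    E.integral.im = -2 * E.κ.re * ZLattice.covolume E.periods.lattice := by
  have : E.form ![1, Complex.I] = E.κ * (1 * (starRingEnd ℂ) Complex.I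
    - Complex.I * (starRingEnd ℂ) 1) := rfl
  rw [integral, this, Complex.im_mul_ofReal]
  simp
  ring

theorem det_mul_complex (a : ℂ) :
    LinearMap.det (LinearMap.mulLeft ℝ a) = Complex.normSq a := by
  rw [← Algebra.norm_complex_apply, Algebra.norm_apply]
  rfl

/-- Multiplication by a non-zero complex number. -/
def mulEquiv (a : ℂ) (ha : a ≠ 0) : ℂ ≃L[ℝ] ℂ :=
  LinearEquiv.toContinuousLinearEquiv
    { LinearMap.mulLeft ℝ a with
      invFun := fun z => a⁻¹ * z
      left_inv := fun z => by simp [ha]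
      right_inv := fun z => by simp [ha] }

/-- Multiplication by `a` scales areas by |a|². It becomes measure preserving when the measure on
the source is multiplied by `r` = |a|², and that factor then comes out of the covolume. -/
theorem covolume_eq_of_mul (L L' : PeriodPair) {a : ℂ} (ha : a ≠ 0)
    (h : ∀ z, a * z ∈ L'.lattice ↔ z ∈ L.lattice) :
    ZLattice.covolume L'.lattice = Complex.normSq a * ZLattice.covolume L.lattice := by
  have hpos : 0 < Complex.normSq a := Complex.normSq_pos.2 ha
  set r := ENNReal.ofReal (Complex.normSq a) with hr
  have hr0 : r ≠ 0 := by simpa [hr] using ha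
  have hrt : r ≠ ⊤ := ENNReal.ofReal_ne_top
  have : (r • (volume : Measure ℂ)).IsAddHaarMeasure :=
    Measure.IsAddHaarMeasure.smul _ hr0 hrt
  have hmp : MeasurePreserving (mulEquiv a ha) (r • (volume : Measure ℂ)) volume := by
    refine ⟨(mulEquiv a ha).continuous.measurable, ?_⟩
    have h1 := Measure.map_linearMap_addHaar_eq_smul_addHaar (volume : Measure ℂ)
      (f := LinearMap.mulLeft ℝ a) (by rw [det_mul_complex]; exact hpos.ne')
    rw [Measure.map_smul]
    change r • Measure.map (LinearMap.mulLeft ℝ a) volume = volume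
    rw [h1, det_mul_complex, smul_smul, hr, abs_of_pos (by positivity), 
      ← ENNReal.ofReal_mul hpos.le, mul_inv_cancel₀ hpos.ne']
    simp
  have h1 := ZLattice.covolume_comap L'.lattice (volume : Measure ℂ)
    (r • (volume : Measure ℂ)) hmp
  have h2 : ZLattice.comap ℝ L'.lattice (mulEquiv a ha).toLinearMap = L.lattice := by
    ext z
    exact h z
  have h3 := (ZLattice.isAddFundamentalDomain (Free.chooseBasis ℤ L.lattice) (volume : Measure ℂ))
  have h4 := (ZLattice.isAddFundamentalDomain (Free.chooseBasis ℤ L.lattice)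
    (r • (volume : Measure ℂ)))
  rw [← h1]
  simp only [h2]
  rw [ZLattice.covolume_eq_measure_fundamentalDomain _ _ h3,
    ZLattice.covolume_eq_measure_fundamentalDomain _ _ h4, measureReal_ennreal_smul_apply, hr,
    ENNReal.toReal_ofReal hpos.le]

/-- `a Λ ⊆ Λ'` gives a homomorphism `ℂ / Λ → ℂ / Λ'`. -/
def mulHom (E E' : KahlerEllipticCurve) (a : ℂ)
    (h : ∀ z ∈ E.periods.lattice, a * z ∈ E'.periods.lattice) : E.Carrier →+ E'.Carrier :=
  QuotientAddGroup.map _ _ (AddMonoidHom.mulLeft a) h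

theorem mulHom_proj (E E' : KahlerEllipticCurve) (a : ℂ)
    (h : ∀ z ∈ E.periods.lattice, a * z ∈ E'.periods.lattice) (z : ℂ) :
    mulHom E E' a h (E.proj z) = E'.proj (a * z) := rfl

theorem contMDiff_mulHom (E E' : KahlerEllipticCurve) (a : ℂ)
    (h : ∀ z ∈ E.periods.lattice, a * z ∈ E'.periods.lattice) :
    ContMDiff 𝓘(ℂ, ℂ) 𝓘(ℂ, ℂ) ω (mulHom E E' a h) := by
  rw [E.isTranslationCover.contMDiff_iff]
  have h1 : ContDiff ℂ ω (fun z : ℂ => a * z) := by fun_prop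
  exact E'.isTranslationCover.contMDiff.comp h1.contMDiff

theorem contMDiff_mulHom_real (E E' : KahlerEllipticCurve) (a : ℂ)
    (h : ∀ z ∈ E.periods.lattice, a * z ∈ E'.periods.lattice) :
    ContMDiff 𝓘(ℝ, ℂ) 𝓘(ℝ, ℂ) ∞ (mulHom E E' a h) := by
  rw [E.isTranslationCover.contMDiff_iff]
  have h1 : ContDiff ℝ ∞ (fun z : ℂ => a * z) := by fun_prop
  exact E'.isTranslationCover.contMDiff.comp h1.contMDiff

theorem hasMFDerivAt_mulHom (E E' : KahlerEllipticCurve) (a : ℂ)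
    (h : ∀ z ∈ E.periods.lattice, a * z ∈ E'.periods.lattice) (p : E.Carrier) :
    HasMFDerivAt 𝓘(ℝ, ℂ) 𝓘(ℝ, ℂ) (mulHom E E' a h) p (ContinuousLinearMap.mul ℝ ℂ a) := by
  refine E.isTranslationCover.hasMFDerivAt_of_comp fun z _ => ?_
  have h1 : HasFDerivAt (fun z : ℂ => a * z) (ContinuousLinearMap.mul ℝ ℂ a) z :=
    (ContinuousLinearMap.mul ℝ ℂ a).hasFDerivAt
  exact (E'.isTranslationCover.hasMFDerivAt (𝕜 := ℝ) (a * z)).comp z h1.hasMFDerivAt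

/-- Multiplication by `a` induces an isometry of `E` and `E'` for the Kähler metrics. -/
structure IsSimilarity (E E' : KahlerEllipticCurve) (a : ℂ) : Prop where
  ne_zero : a ≠ 0
  mul_mem_iff : ∀ z, a * z ∈ E'.periods.lattice ↔ z ∈ E.periods.lattice
  im_eq : E'.κ.im * Complex.normSq a = E.κ.im

theorem IsSimilarity.symm {E E' : KahlerEllipticCurve} {a : ℂ} (h : E.IsSimilarity E' a) :
    E'.IsSimilarity E a⁻¹ := by
  have ha := h.ne_zero
  refine ⟨inv_ne_zero ha, fun z => ?_, ?_⟩
  · rw [← h.mul_mem_iff, mul_inv_cancel_left₀ ha]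
  · have := Complex.normSq_pos.2 ha
    rw [← h.im_eq, map_inv₀, mul_inv_cancel_right₀ this.ne']

/-- An entire function with bounded derivative is affine. -/
theorem eq_mul_add_of_isBounded_range_deriv {F : ℂ → ℂ} (hF : Differentiable ℂ F)
    (hF' : Differentiable ℂ (deriv F)) (hb : Bornology.IsBounded (range (deriv F))) (z : ℂ) :
    F z = deriv F 0 * z + F 0 := by
  have hd : ∀ x, HasDerivAt (fun x => F x - deriv F 0 * x) 0 x := by
    intro x
    have := (hF x).hasDerivAt.sub ((hasDerivAt_id x).const_mul (deriv F 0))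
    -- Liouville's theorem: the bounded entire function F' is constant.
    rw [hF'.apply_eq_apply_of_bounded hb x 0] at this
    simpa using! this
  have := is_const_of_deriv_eq_zero (fun x => (hd x).differentiableAt)
    (fun x => (hd x).deriv) z 0
  simp only [mul_zero, sub_zero] at this
  linear_combination this

/-- A biholomorphic map between elliptic curves is affine. -/
theorem exists_mul_of_diffeomorph {E E' : KahlerEllipticCurve}
    (f : Diffeomorph 𝓘(ℂ, ℂ) 𝓘(ℂ, ℂ) E.Carrier E'.Carrier ω) :
    ∃ a : ℂ, a ≠ 0 ∧ ∀ z, a * z ∈ E'.periods.lattice ↔ z ∈ E.periods.lattice := by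
  have hsm : ContMDiff 𝓘(ℂ, ℂ) 𝓘(ℂ, ℂ) ω (fun z => f (E.proj z)) :=
    f.contMDiff.comp E.isTranslationCover.contMDiff
  obtain ⟨w, hw⟩ := E'.proj_surjective (f (E.proj 0))
  obtain ⟨F, hFc, -, hF⟩ := E'.isTranslationCover.exists_lift hsm.continuous 0 hw
  have hFs : ContDiff ℂ ω F :=
    (E'.isTranslationCover.contMDiff_of_lift hFc (by simpa only [hF] using hsm)).contDiff
  have hFd : Differentiable ℂ F := hFs.differentiable (by simp)
  have hiff : ∀ z z', F z - F z' ∈ E'.periods.lattice ↔ z - z' ∈ E.periods.lattice := by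
    intro z z'
    rw [← proj_eq_iff, ← proj_eq_iff, hF, hF]
    exact f.injective.eq_iff
  -- Translating the argument by a period changes `F` by a locally constant function. Hence F' is
  -- periodic for the lattice and, being continuous, bounded.
  have hper : ∀ z l, l ∈ E.periods.lattice → deriv F (z + l) = deriv F z := by
    intro z l hl
    have h1 : ∀ᶠ x in 𝓝 z, F (x + l) = F x + (F (z + l) - F z) := by
      refine E'.isTranslationCover.eventually_sub_eq (f := fun x => F (x + l)) (g := F)
        (by fun_prop) (by fun_prop) (Filter.Eventually.of_forall fun x => ?_)
      rw [proj_eq_iff, hiff]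
      simpa using hl
    have h2 := Filter.EventuallyEq.deriv_eq h1
    rwa [deriv_comp_add_const, deriv_add_const] at h2
  have hF' : Differentiable ℂ (deriv F) := by
    have : ContDiff ℂ 1 (deriv F) := (hFs.of_le (by simp)).deriv' (n := 1)
    exact this.differentiable (by simp)
  have hb := (IsZLattice.isCompact_range_of_periodic E.periods.lattice _
    hF'.continuous hper).isBounded
  have hconst := eq_mul_add_of_isBounded_range_deriv hFd hF' hb
  have hmem : ∀ z, deriv F 0 * z ∈ E'.periods.lattice ↔ z ∈ E.periods.lattice := by
    intro z
    have := hiff z 0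
    rw [hconst z, hconst 0] at this
    simpa using this
  refine ⟨deriv F 0, fun h0 => ?_, hmem⟩
  -- With slope 0 every complex number would be a period; half of a basic period is not.
  refine E.periods.ω₁_div_two_notMem_lattice ((hmem _).1 ?_)
  simp [h0]

/-- A biholomorphic map is affine with some slope a, and the covolumes differ by |a|². Equality of
the real parts of the integrals is then the relation between the two values of Im κ in
`IsSimilarity`; the integer ambiguity concerns only the imaginary parts. -/
theorem iso_iff {E E' : KahlerEllipticCurve} :
    E.Iso E' ↔ (∃ a, E.IsSimilarity E' a) ∧ ∃ k : ℤ, E'.integral.im - E.integral.im = k := by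
  constructor
  · rintro ⟨⟨f⟩, k, hk⟩
    have hre := congrArg Complex.re hk
    have him := congrArg Complex.im hk
    simp only [Complex.sub_re, Complex.sub_im, Complex.mul_re, Complex.mul_im, Complex.I_re,
      Complex.I_im, Complex.intCast_re, Complex.intCast_im] at hre him
    obtain ⟨a, ha, h⟩ := exists_mul_of_diffeomorph f
    refine ⟨⟨a, ha, h, ?_⟩, k, by simpa using him⟩
    have h1 := ZLattice.covolume_pos E.periods.lattice
    rw [integral_re, integral_re, covolume_eq_of_mul _ _ ha h] at hre
    have : (E'.κ.im * Complex.normSq a - E.κ.im) * ZLattice.covolume E.periods.lattice = 0 := by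
      linear_combination hre / 2
    have := (mul_eq_zero.1 this).resolve_right h1.ne'
    linarith
  · rintro ⟨⟨a, h⟩, k, hk⟩
    have h1 : ∀ z ∈ E.periods.lattice, a * z ∈ E'.periods.lattice :=
      fun z hz => (h.mul_mem_iff z).2 hz
    have h2 : ∀ z ∈ E'.periods.lattice, a⁻¹ * z ∈ E.periods.lattice :=
      fun z hz => (h.symm.mul_mem_iff z).2 hz
    refine ⟨⟨{ toFun := mulHom E E' a h1, invFun := mulHom E' E a⁻¹ h2,
               left_inv := ?_, right_inv := ?_,
               contMDiff_toFun := contMDiff_mulHom E E' a h1,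
               contMDiff_invFun := contMDiff_mulHom E' E a⁻¹ h2 }⟩, k, ?_⟩
    · intro p
      obtain ⟨z, rfl⟩ := E.proj_surjective p
      simp [mulHom_proj, h.ne_zero]
    · intro p
      obtain ⟨z, rfl⟩ := E'.proj_surjective p
      simp [mulHom_proj, h.ne_zero]
    · apply Complex.ext
      · simp only [Complex.sub_re, integral_re, covolume_eq_of_mul _ _ h.ne_zero h.mul_mem_iff,
          ← h.im_eq]
        simp
        ring
      · simpa using hk

end KahlerEllipticCurve

open KahlerEllipticCurve

/-! ### Coordinates on the fibre product -/

section Coordinates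

variable (τ t : UpperHalfPlane)

theorem isTranslationCover_fibreCover : IsTranslationCover (fibreCover τ t) :=
  isTranslationCover_chartedSpace _ (isLocalHomeomorph_fibreCover τ t) (fibreCover_surjective τ t)

theorem isTranslationCover_circle :
    IsTranslationCover (QuotientAddGroup.mk' (AddSubgroup.zmultiples (1 : ℝ))) :=
  isTranslationCover_chartedSpace (QuotientAddGroup.mk' (AddSubgroup.zmultiples (1 : ℝ)))
    (AddCircle.isLocalHomeomorph_coe (1 : ℝ)) circle_coe_surjective

/-- The differential of `fibreFst`. -/
def tangentFst : fibreTangent τ t →L[ℝ] ℂ :=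
  (ContinuousLinearMap.fst ℝ ℂ ℂ).comp (fibreTangent τ t).subtypeL

/-- The differential of `fibreSnd`. -/
def tangentSnd : fibreTangent τ t →L[ℝ] ℂ :=
  (ContinuousLinearMap.snd ℝ ℂ ℂ).comp (fibreTangent τ t).subtypeL

/-- The differential of `fibreBase`. -/
def tangentBase : fibreTangent τ t →L[ℝ] ℝ :=
  τ.im⁻¹ • Complex.imCLM.comp (tangentFst τ t)

theorem hasMFDerivAt_fibreFst (p : fibreProduct τ t) :
    HasMFDerivAt 𝓘(ℝ, fibreTangent τ t) 𝓘(ℝ, ℂ) (fibreFst τ t) p (tangentFst τ t) := by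
  refine (isTranslationCover_fibreCover τ t).hasMFDerivAt_of_comp fun v _ => ?_
  exact ((standard τ t).isTranslationCover.hasMFDerivAt (𝕜 := ℝ) (tangentFst τ t v)).comp v
    (tangentFst τ t).hasFDerivAt.hasMFDerivAt

theorem hasMFDerivAt_fibreSnd (p : fibreProduct τ t) :
    HasMFDerivAt 𝓘(ℝ, fibreTangent τ t) 𝓘(ℝ, ℂ) (fibreSnd τ t) p (tangentSnd τ t) := by
  refine (isTranslationCover_fibreCover τ t).hasMFDerivAt_of_comp fun v _ => ?_
  exact ((standard t τ).isTranslationCover.hasMFDerivAt (𝕜 := ℝ) (tangentSnd τ t v)).comp v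
    (tangentSnd τ t).hasFDerivAt.hasMFDerivAt

theorem hasMFDerivAt_fibreBase (p : fibreProduct τ t) :
    HasMFDerivAt 𝓘(ℝ, fibreTangent τ t) 𝓘(ℝ, ℝ) (fibreBase τ t) p (tangentBase τ t) := by
  refine (isTranslationCover_fibreCover τ t).hasMFDerivAt_of_comp fun v _ => ?_
  have h : fibreBase τ t ∘ fibreCover τ t = QuotientAddGroup.mk' (AddSubgroup.zmultiples (1 : ℝ)) ∘
      tangentBase τ t := by
    funext u
    change ((u.1.1.im * τ.im⁻¹ : ℝ) : UnitAddCircle) = ((τ.im⁻¹ * u.1.1.im : ℝ) : UnitAddCircle)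
    rw [mul_comm]
  rw [h]
  exact (isTranslationCover_circle.hasMFDerivAt (𝕜 := ℝ) (tangentBase τ t v)).comp v
    (tangentBase τ t).hasFDerivAt.hasMFDerivAt

theorem contMDiff_fibreFst :
    ContMDiff 𝓘(ℝ, fibreTangent τ t) 𝓘(ℝ, ℂ) ∞ (fibreFst τ t) := by
  rw [(isTranslationCover_fibreCover τ t).contMDiff_iff]
  exact (standard τ t).isTranslationCover.contMDiff.comp (tangentFst τ t).contDiff.contMDiff

/-- The vector `(x + i h Im τ, y + i h Im t)`. -/
def fibreVector (h x y : ℝ) : fibreTangent τ t :=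
  ⟨(⟨x, h * τ.im⟩, ⟨y, h * t.im⟩), by
    change h * τ.im * τ.im⁻¹ = h * t.im * t.im⁻¹
    rw [mul_inv_cancel_right₀ τ.im_pos.ne', mul_inv_cancel_right₀ t.im_pos.ne']⟩

variable {τ t}

theorem im_fst (u : fibreTangent τ t) : u.1.1.im = tangentBase τ t u * τ.im := by
  have := τ.im_pos.ne'
  change u.1.1.im = τ.im⁻¹ * u.1.1.im * τ.im
  field_simp

theorem im_snd (u : fibreTangent τ t) : u.1.2.im = tangentBase τ t u * t.im := by
  have h : u.1.1.im * τ.im⁻¹ = u.1.2.im * t.im⁻¹ := u.2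
  have := t.im_pos.ne'
  change u.1.2.im = τ.im⁻¹ * u.1.1.im * t.im
  rw [mul_comm τ.im⁻¹, h]
  field_simp

@[simp] theorem tangentBase_fibreVector (h x y : ℝ) :
    tangentBase τ t (fibreVector τ t h x y) = h := by
  have := τ.im_pos.ne'
  change τ.im⁻¹ * (h * τ.im) = h
  field_simp

@[simp] theorem re_fst_fibreVector (h x y : ℝ) : (fibreVector τ t h x y).1.1.re = x := rfl

@[simp] theorem re_snd_fibreVector (h x y : ℝ) : (fibreVector τ t h x y).1.2.re = y := rfl

theorem fibreTangent_ext {u u' : fibreTangent τ t} (h : tangentBase τ t u = tangentBase τ t u')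
    (h₁ : u.1.1.re = u'.1.1.re) (h₂ : u.1.2.re = u'.1.2.re) : u = u' := by
  refine Subtype.ext (Prod.ext (Complex.ext h₁ ?_) (Complex.ext h₂ ?_))
  · rw [im_fst, im_fst, h]
  · rw [im_snd, im_snd, h]

theorem tangentFst_eq_zero_iff (u : fibreTangent τ t) :
    tangentFst τ t u = 0 ↔ tangentBase τ t u = 0 ∧ u.1.1.re = 0 := by
  have := τ.im_pos.ne'
  change u.1.1 = 0 ↔ _
  rw [Complex.ext_iff, im_fst, and_comm]
  simp [this]

theorem tangentSnd_eq_zero_iff (u : fibreTangent τ t) :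
    tangentSnd τ t u = 0 ↔ tangentBase τ t u = 0 ∧ u.1.2.re = 0 := by
  have := t.im_pos.ne'
  change u.1.2 = 0 ↔ _
  rw [Complex.ext_iff, im_snd, and_comm]
  simp [this]

theorem standard_κ_im : (standard τ t).κ.im = -(t.im / (2 * τ.im)) := by
  have h : (2 * τ.im : ℂ) = ((2 * τ.im : ℝ) : ℂ) := by push_cast; rfl
  change (-(t : ℂ) / (2 * τ.im)).im = _
  rw [h, Complex.div_ofReal_im]
  simp [neg_div]

theorem standard_κ_re : (standard τ t).κ.re = -(t.re / (2 * τ.im)) := by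
  have h : (2 * τ.im : ℂ) = ((2 * τ.im : ℝ) : ℂ) := by push_cast; rfl
  change (-(t : ℂ) / (2 * τ.im)).re = _
  rw [h, Complex.div_ofReal_re]
  simp [neg_div]

/-! ### The forms and the metric in the coordinates s, x, y. -/

theorem kahlerForm_apply (E : KahlerEllipticCurve) (p : E.Carrier) (a b : ℂ) :
    E.kahlerForm p ![a, b] = -2 * E.κ.im * (a.im * b.re - b.im * a.re) := by
  change (E.κ * (a * (starRingEnd ℂ) b - b * (starRingEnd ℂ) a)).re = _
  simp
  ring

theorem metric_apply (E : KahlerEllipticCurve) (p : E.Carrier) (a b : ℂ) :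
    E.metric p a b = -2 * E.κ.im * (a.re * b.re + a.im * b.im) := by
  change (-2 * E.κ.im) * inner ℝ a b = _
  rw [Complex.inner]
  simp only [Complex.mul_re, Complex.conj_re, Complex.conj_im]
  ring

variable (τ t) in
/-- The constant value of `ω₁`. -/
def constForm₁ : fibreTangent τ t [⋀^Fin 2]→L[ℝ] ℝ :=
  (Complex.reCLM.compContinuousAlternatingMap (standard τ t).form).compContinuousLinearMap
    (tangentFst τ t)

variable (τ t) in
/-- The constant value of `ω₂`. -/
def constForm₂ : fibreTangent τ t [⋀^Fin 2]→L[ℝ] ℝ :=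
  (Complex.reCLM.compContinuousAlternatingMap (standard t τ).form).compContinuousLinearMap
    (tangentSnd τ t)

variable (τ t) in
/-- The constant value of the metric. -/
def constMetric : fibreTangent τ t →L[ℝ] fibreTangent τ t →L[ℝ] ℝ :=
  pullbackBilin ((-2 * (standard τ t).κ.im) • innerSL ℝ : ℂ →L[ℝ] ℂ →L[ℝ] ℝ) (tangentFst τ t)
    + pullbackBilin ((-2 * (standard t τ).κ.im) • innerSL ℝ : ℂ →L[ℝ] ℂ →L[ℝ] ℝ) (tangentSnd τ t)
    - pullbackBilin ((τ.im * t.im) • innerSL ℝ : ℝ →L[ℝ] ℝ →L[ℝ] ℝ) (tangentBase τ t)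

theorem mirror_ω₁_eq (p : fibreProduct τ t) : (mirrorManifold τ t).ω₁ p = constForm₁ τ t := by
  simp only [mirrorManifold, (hasMFDerivAt_fibreFst τ t p).mfderiv]
  rfl

theorem mirror_ω₂_eq (p : fibreProduct τ t) : (mirrorManifold τ t).ω₂ p = constForm₂ τ t := by
  simp only [mirrorManifold, (hasMFDerivAt_fibreSnd τ t p).mfderiv]
  rfl

theorem mirror_g_eq (p : fibreProduct τ t) : (mirrorManifold τ t).g p = constMetric τ t := by
  simp only [mirrorManifold, (hasMFDerivAt_fibreFst τ t p).mfderiv,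
    (hasMFDerivAt_fibreSnd τ t p).mfderiv, (hasMFDerivAt_fibreBase τ t p).mfderiv]
  rfl

/-- This is Im t ds ∧ dx: the coefficient Im t / Im τ of the Kähler form meets Im z = s Im τ, where
s is `tangentBase`. -/
theorem mirror_ω₁_apply (p : fibreProduct τ t) (u u' : fibreTangent τ t) :
    (mirrorManifold τ t).ω₁ p ![u, u'] =
      t.im * (tangentBase τ t u * u'.1.1.re - tangentBase τ t u' * u.1.1.re) := by
  have hτ := τ.im_pos.ne'
  rw [mirror_ω₁_eq]
  refine (kahlerForm_apply (standard τ t) 0 u.1.1 u'.1.1).trans ?_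
  rw [im_fst, im_fst, standard_κ_im]
  field_simp

theorem mirror_ω₂_apply (p : fibreProduct τ t) (u u' : fibreTangent τ t) :
    (mirrorManifold τ t).ω₂ p ![u, u'] =
      τ.im * (tangentBase τ t u * u'.1.2.re - tangentBase τ t u' * u.1.2.re) := by
  have ht := t.im_pos.ne'
  rw [mirror_ω₂_eq]
  refine (kahlerForm_apply (standard t τ) 0 u.1.2 u'.1.2).trans ?_
  rw [im_snd, im_snd, standard_κ_im]
  field_simp

/-- Each Kähler metric contributes Im τ Im t ds², and subtracting the metric of the base leaves one
copy. The coordinates s, x, y are orthogonal for the result. -/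
theorem constMetric_apply (u u' : fibreTangent τ t) :
    constMetric τ t u u' = t.im / τ.im * (u.1.1.re * u'.1.1.re) +
      τ.im / t.im * (u.1.2.re * u'.1.2.re) +
      τ.im * t.im * (tangentBase τ t u * tangentBase τ t u') := by
  have hτ := τ.im_pos.ne'
  have ht := t.im_pos.ne'
  change (standard τ t).metric 0 u.1.1 u'.1.1 + (standard t τ).metric 0 u.1.2 u'.1.2
    - (τ.im * t.im) * inner ℝ (tangentBase τ t u) (tangentBase τ t u') = _
  rw [metric_apply, metric_apply, im_fst, im_fst, im_snd, im_snd, standard_κ_im, standard_κ_im]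
  simp only [RCLike.inner_apply, conj_trivial]
  field_simp
  ring

theorem mirror_g_apply (p : fibreProduct τ t) (u u' : fibreTangent τ t) :
    (mirrorManifold τ t).g p u u' = t.im / τ.im * (u.1.1.re * u'.1.1.re) +
      τ.im / t.im * (u.1.2.re * u'.1.2.re) +
      τ.im * t.im * (tangentBase τ t u * tangentBase τ t u') := by
  rw [mirror_g_eq]
  exact constMetric_apply u u'

theorem mem_perp_ω₁ (p : fibreProduct τ t) (u : fibreTangent τ t) :
    u ∈ TwoFormField.perp (mirrorManifold τ t).ω₁ p ↔ tangentFst τ t u = 0 := by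
  have ht := t.im_pos.ne'
  rw [tangentFst_eq_zero_iff]
  constructor
  · intro h
    -- Pairing with ∂_x reads off the s-component of `u`, pairing with ∂_s its x-component.
    have h1 := (mirror_ω₁_apply p u (fibreVector τ t 0 1 0)).symm.trans
      (h (fibreVector τ t 0 1 0))
    have h2 := (mirror_ω₁_apply p u (fibreVector τ t 1 0 0)).symm.trans
      (h (fibreVector τ t 1 0 0))
    simpa [ht] using And.intro h1 h2
  · rintro ⟨h1, h2⟩ u'
    exact (mirror_ω₁_apply p u u').trans (by simp [h1, h2])

theorem mem_perp_ω₂ (p : fibreProduct τ t) (u : fibreTangent τ t) :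
    u ∈ TwoFormField.perp (mirrorManifold τ t).ω₂ p ↔ tangentSnd τ t u = 0 := by
  have hτ := τ.im_pos.ne'
  rw [tangentSnd_eq_zero_iff]
  constructor
  · intro h
    have h1 := (mirror_ω₂_apply p u (fibreVector τ t 0 0 1)).symm.trans
      (h (fibreVector τ t 0 0 1))
    have h2 := (mirror_ω₂_apply p u (fibreVector τ t 1 0 0)).symm.trans
      (h (fibreVector τ t 1 0 0))
    simpa [hτ] using And.intro h1 h2
  · rintro ⟨h1, h2⟩ u'
    exact (mirror_ω₂_apply p u u').trans (by simp [h1, h2])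

theorem mem_vertical (p : fibreProduct τ t) (u : fibreTangent τ t) :
    u ∈ (mirrorManifold τ t).vertical p ↔ tangentBase τ t u = 0 := by
  refine (Submodule.mem_sup (R := ℝ) (M := TangentSpace 𝓘(ℝ, fibreTangent τ t) p)
    (x := u)).trans ?_
  constructor
  · rintro ⟨a, ha, b, hb, rfl⟩
    have h1 := ((tangentFst_eq_zero_iff _).1 ((mem_perp_ω₁ p a).1 ha)).1
    have h2 := ((tangentSnd_eq_zero_iff _).1 ((mem_perp_ω₂ p b).1 hb)).1
    exact (map_add (tangentBase τ t) _ _).trans (by rw [h1, h2, add_zero])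
  · intro h
    -- A vector with s = 0 splits into a multiple of ∂_y, which spans ω₁^⊥, and a multiple of ∂_x,
    -- which spans ω₂^⊥.
    refine ⟨fibreVector τ t 0 0 u.1.2.re, ?_, fibreVector τ t 0 u.1.1.re 0, ?_, ?_⟩
    · exact (mem_perp_ω₁ p _).2 ((tangentFst_eq_zero_iff _).2 (by simp))
    · exact (mem_perp_ω₂ p _).2 ((tangentSnd_eq_zero_iff _).2 (by simp))
    · refine fibreTangent_ext (τ := τ) (t := t) ?_ ?_ ?_
      · exact (map_add (tangentBase τ t) _ _).trans (by simp [h])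
      · exact zero_add _
      · exact add_zero _

/-! ### Leaves -/

theorem proj_standard_eq_iff (z w : ℂ) : (standard τ t).proj z = (standard τ t).proj w ↔
    ∃ m n : ℤ, z.im - w.im = m * τ.im ∧ z.re - w.re = m * τ.re + n := by
  rw [proj_eq_iff, PeriodPair.mem_lattice]
  refine exists_congr fun m => exists_congr fun n => ?_
  rw [Complex.ext_iff]
  simp [standard]
  constructor <;> rintro ⟨h1, h2⟩ <;> constructor <;> linarith

/-- The coordinate s is shared by both factors, so the coefficients of τ and of t in the two periods
are the same integer m. The deck group has the generators (1, Re τ, Re t), (0, 1, 0), (0, 0, 1). -/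
theorem fibreCover_eq_iff (u u' : fibreTangent τ t) :
    fibreCover τ t u = fibreCover τ t u' ↔ ∃ m n k : ℤ,
      tangentBase τ t u - tangentBase τ t u' = m ∧ u.1.1.re - u'.1.1.re = m * τ.re + n ∧
      u.1.2.re - u'.1.2.re = m * t.re + k := by
  have hτ := τ.im_pos.ne'
  have ht := t.im_pos.ne'
  rw [Subtype.ext_iff, Prod.ext_iff]
  change (standard τ t).proj u.1.1 = (standard τ t).proj u'.1.1 ∧
    (standard t τ).proj u.1.2 = (standard t τ).proj u'.1.2 ↔ _
  rw [proj_standard_eq_iff, proj_standard_eq_iff, im_fst, im_fst, im_snd, im_snd]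
  simp only [← sub_mul, mul_left_inj' hτ, mul_left_inj' ht]
  constructor
  · rintro ⟨⟨m, n, h1, h2⟩, ⟨m', k, h3, h4⟩⟩
    have : m' = m := by exact_mod_cast h3.symm.trans h1
    subst this
    exact ⟨m', n, k, h1, h2, h4⟩
  · rintro ⟨m, n, k, h1, h2, h3⟩
    exact ⟨⟨m, n, h1, h2⟩, ⟨m, k, h1, h3⟩⟩

theorem mem_leaf_vertical (u u' : fibreTangent τ t) :
    fibreCover τ t u' ∈ (mirrorManifold τ t).vertical.leaf (fibreCover τ t u) ↔
      ∃ m : ℤ, tangentBase τ t u' - tangentBase τ t u = m := by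
  rw [(isTranslationCover_fibreCover τ t).mem_leaf_iff (tangentBase τ t) mem_vertical]
  constructor
  · rintro ⟨w, h1, h2⟩
    obtain ⟨m, n, k, h3, -⟩ := (fibreCover_eq_iff _ _).1 h1.symm
    exact ⟨m, by rw [← h3, h2]⟩
  · rintro ⟨m, hm⟩
    -- Subtracting `m` times the generator (1, Re τ, Re t) brings the s-coordinates into agreement.
    refine ⟨u' - fibreVector τ t m (m * τ.re) (m * t.re), (fibreCover_eq_iff _ _).2 
      ⟨-m, 0, 0, ?_, ?_, ?_⟩, ?_⟩
    · simp
    · simp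
    · simp
    · simp [← hm]

theorem mem_leaf_ω₁ (u u' : fibreTangent τ t) :
    fibreCover τ t u' ∈ (TwoFormField.perp (mirrorManifold τ t).ω₁).leaf (fibreCover τ t u) ↔
      ∃ m n : ℤ, tangentBase τ t u' - tangentBase τ t u = m ∧
        u'.1.1.re - u.1.1.re = m * τ.re + n := by
  rw [(isTranslationCover_fibreCover τ t).mem_leaf_iff (tangentFst τ t) mem_perp_ω₁]
  constructor
  · rintro ⟨w, h1, h2⟩
    obtain ⟨m, n, k, h3, h4, -⟩ := (fibreCover_eq_iff _ _).1 h1.symm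
    rw [← sub_eq_zero, ← map_sub, tangentFst_eq_zero_iff] at h2
    have h5 : tangentBase τ t w - tangentBase τ t u = 0 := by rw [← map_sub, h2.1]
    have h6 : w.1.1.re - u.1.1.re = 0 := h2.2
    exact ⟨m, n, by linarith, by linarith⟩
  · rintro ⟨m, n, hm, hn⟩
    refine ⟨u' - fibreVector τ t m (m * τ.re + n) (m * t.re), (fibreCover_eq_iff _ _).2 
      ⟨-m, -n, 0, ?_, ?_, ?_⟩, ?_⟩
    · simp
    · simp
      linarith
    · simp
    · rw [← sub_eq_zero, ← map_sub, tangentFst_eq_zero_iff]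
      constructor <;> simp <;> linarith

/-- The shear of y by Re t along a turn of the base, visible here, is what the monodromy measures.
-/
theorem mem_leaf_ω₂ (u u' : fibreTangent τ t) :
    fibreCover τ t u' ∈ (TwoFormField.perp (mirrorManifold τ t).ω₂).leaf (fibreCover τ t u) ↔
      ∃ m k : ℤ, tangentBase τ t u' - tangentBase τ t u = m ∧
        u'.1.2.re - u.1.2.re = m * t.re + k := by
  rw [(isTranslationCover_fibreCover τ t).mem_leaf_iff (tangentSnd τ t) mem_perp_ω₂]
  constructor
  · rintro ⟨w, h1, h2⟩
    obtain ⟨m, n, k, h3, -, h4⟩ := (fibreCover_eq_iff _ _).1 h1.symm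
    rw [← sub_eq_zero, ← map_sub, tangentSnd_eq_zero_iff] at h2
    have h5 : tangentBase τ t w - tangentBase τ t u = 0 := by rw [← map_sub, h2.1]
    have h6 : w.1.2.re - u.1.2.re = 0 := h2.2
    exact ⟨m, k, by linarith, by linarith⟩
  · rintro ⟨m, k, hm, hk⟩
    refine ⟨u' - fibreVector τ t m (m * τ.re) (m * t.re + k), (fibreCover_eq_iff _ _).2 
      ⟨-m, 0, -k, ?_, ?_, ?_⟩, ?_⟩
    · simp
    · simp
    · simp
      linarith
    · rw [← sub_eq_zero, ← map_sub, tangentSnd_eq_zero_iff]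
      constructor <;> simp <;> linarith

end Coordinates

/-! ### Adapted bases -/

section Adapted

variable {τ t : UpperHalfPlane}

variable (τ t) in
/-- Rescaled coordinates on the tangent spaces. -/
def scaledCoordinates (a b c : ℝ) (ha : a ≠ 0) (hb : b ≠ 0) (hc : c ≠ 0) :
    fibreTangent τ t ≃ₗ[ℝ] (Fin 3 × Fin 1 → ℝ) where
  toFun u i := ![a * tangentBase τ t u, b * u.1.1.re, c * u.1.2.re] i.1
  map_add' u u' := by
    funext ⟨i, j⟩
    fin_cases i <;> simp [mul_add]
  map_smul' r u := by
    funext ⟨i, j⟩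
    fin_cases i <;> simp <;> ring
  invFun x := fibreVector τ t (a⁻¹ * x (0, 0)) (b⁻¹ * x (1, 0)) (c⁻¹ * x (2, 0))
  left_inv u := by
    apply fibreTangent_ext <;> simp [ha, hb, hc]
  right_inv x := by
    funext ⟨i, j⟩
    rw [Subsingleton.elim j 0]
    fin_cases i <;> simp [ha, hb, hc]

variable (τ t) in
/-- The basis `h ∂_s, h Im τ ∂_x, h Im t ∂_y`. -/
def scaledFrame (h : ℝ) (hh : τ.im * t.im * h ^ 2 = 1) :
    Basis (Fin 3 × Fin 1) ℝ (fibreTangent τ t) :=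
  have h0 : h ≠ 0 := by rintro rfl; simp at hh
  Basis.ofEquivFun (scaledCoordinates τ t (τ.im * t.im * h) (t.im * h) (τ.im * h)
    (by simp [h0, τ.im_pos.ne', t.im_pos.ne']) (by simp [h0, t.im_pos.ne'])
    (by simp [h0, τ.im_pos.ne']))

theorem scaledFrame_coord (h : ℝ) (hh : τ.im * t.im * h ^ 2 = 1) (i : Fin 3 × Fin 1)
    (u : fibreTangent τ t) : (scaledFrame τ t h hh).coord i u =
      ![τ.im * t.im * h * tangentBase τ t u, t.im * h * u.1.1.re, τ.im * h * u.1.2.re] i.1 := rfl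

/-- By `hh` the inverses of the scales Im τ Im t h, Im t h, Im τ h are h, Im τ h, Im t h, so the
dual frame needs no division. -/
theorem eq_fibreVector_of_coord {h : ℝ} (hh : τ.im * t.im * h ^ 2 = 1) (u : fibreTangent τ t) :
    u = fibreVector τ t (h * (τ.im * t.im * h * tangentBase τ t u))
      (τ.im * h * (t.im * h * u.1.1.re)) (t.im * h * (τ.im * h * u.1.2.re)) := by
  apply fibreTangent_ext
  · rw [tangentBase_fibreVector]
    linear_combination (-tangentBase τ t u) * hh
  · rw [re_fst_fibreVector]
    linear_combination (-u.1.1.re) * hh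
  · rw [re_snd_fibreVector]
    linear_combination (-u.1.2.re) * hh

theorem scaledFrame_apply (h : ℝ) (hh : τ.im * t.im * h ^ 2 = 1) :
    scaledFrame τ t h hh (0, 0) = fibreVector τ t h 0 0 ∧
    scaledFrame τ t h hh (1, 0) = fibreVector τ t 0 (τ.im * h) 0 ∧
    scaledFrame τ t h hh (2, 0) = fibreVector τ t 0 0 (t.im * h) := by
  have key : ∀ i, scaledFrame τ t h hh i = fibreVector τ t
      (h * (scaledFrame τ t h hh).coord (0, 0) (scaledFrame τ t h hh i))
      (τ.im * h * (scaledFrame τ t h hh).coord (1, 0) (scaledFrame τ t h hh i))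
      (t.im * h * (scaledFrame τ t h hh).coord (2, 0) (scaledFrame τ t h hh i)) := by
    intro i
    exact eq_fibreVector_of_coord hh _
  refine ⟨?_, ?_, ?_⟩ <;> rw [key] <;> simp

theorem scaledFrame_isAdaptedBasis (p : fibreProduct τ t) (h : ℝ)
    (hh : τ.im * t.im * h ^ 2 = 1) :
    (mirrorManifold τ t).IsAdaptedBasis (n := 1) p (scaledFrame τ t h hh) := by
  have hτ := τ.im_pos.ne'
  have ht := t.im_pos.ne'
  refine ⟨fun u u' => ?_, fun u u' => ?_, ?_⟩
  · refine (mirror_ω₁_apply p u u').trans ?_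
    simp only [Fin.sum_univ_one, Fin.isValue]
    erw [scaledFrame_coord, scaledFrame_coord, scaledFrame_coord, scaledFrame_coord]
    simp only [Matrix.cons_val]
    linear_combination (-t.im *
      (tangentBase τ t u * u'.1.1.re - tangentBase τ t u' * u.1.1.re)) * hh
  · refine (mirror_ω₂_apply p u u').trans ?_
    simp only [Fin.sum_univ_one, Fin.isValue]
    erw [scaledFrame_coord, scaledFrame_coord, scaledFrame_coord, scaledFrame_coord]
    simp only [Matrix.cons_val]
    linear_combination (-τ.im *
      (tangentBase τ t u * u'.1.2.re - tangentBase τ t u' * u.1.2.re)) * hh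
  · obtain ⟨h0, h1, h2⟩ := scaledFrame_apply h hh
    have e1 : t.im / τ.im * (τ.im * h * (τ.im * h)) = 1 := by
      rw [← hh]; field_simp
    have e2 : τ.im / t.im * (t.im * h * (t.im * h)) = 1 := by
      rw [← hh]; field_simp
    have e3 : τ.im * t.im * (h * h) = 1 := by rw [← hh]; ring
    have key : ∀ i j, constMetric τ t (scaledFrame τ t h hh (i, 0)) (scaledFrame τ t h hh (j, 0)) =
        if i = j then 1 else 0 := by
      intro i j
      rw [constMetric_apply]
      fin_cases i <;> fin_cases j <;> simp [h0, h1, h2, e1, e2, e3]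
    rintro ⟨i, i'⟩ ⟨j, j'⟩
    rw [Subsingleton.elim i' 0, Subsingleton.elim j' 0, mirror_g_eq]
    simpa using! key i j

/-- An adapted basis is unique up to sign. -/
theorem IsAdaptedBasis.eq_fibreVector {p : fibreProduct τ t}
    {b : Basis (Fin 3 × Fin 1) ℝ (TangentSpace 𝓘(ℝ, fibreTangent τ t) p)}
    (hb : (mirrorManifold τ t).IsAdaptedBasis p b) :
    ∃ h : ℝ, τ.im * t.im * h ^ 2 = 1 ∧ b (0, 0) = fibreVector τ t h 0 0 ∧
      b (1, 0) = fibreVector τ t 0 (τ.im * h) 0 ∧ b (2, 0) = fibreVector τ t 0 0 (t.im * h) := by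
  have hτ := τ.im_pos
  have ht := t.im_pos
  obtain ⟨hω₁, hω₂, hg⟩ := hb
  -- The formula for ω₂ does not involve the coordinate dual to w¹, nor that for ω₁ the one dual to
  -- w². Hence w¹ is a multiple of ∂_x and w² a multiple of ∂_y.
  have hb1 : b (1, 0) ∈ TwoFormField.perp (mirrorManifold τ t).ω₂ p := by
    intro u'
    rw [hω₂]
    simp
  have hb2 : b (2, 0) ∈ TwoFormField.perp (mirrorManifold τ t).ω₁ p := by
    intro u'
    rw [hω₁]
    simp
  have h01 := hω₁ (b (0, 0)) (b (1, 0))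
  have h02 := hω₂ (b (0, 0)) (b (2, 0))
  have g00 := hg (0, 0) (0, 0)
  have g01 := hg (0, 0) (1, 0)
  have g02 := hg (0, 0) (2, 0)
  have g11 := hg (1, 0) (1, 0)
  have g22 := hg (2, 0) (2, 0)
  simp only [Fin.sum_univ_one, Basis.coord_apply, Basis.repr_self, Finsupp.single_apply] at h01 h02
  generalize hv : b (0, 0) = v at *
  generalize hw : b (1, 0) = w₁ at *
  generalize hw' : b (2, 0) = w₂ at *
  change fibreTangent τ t at v w₁ w₂
  obtain ⟨a1, a2⟩ := (tangentSnd_eq_zero_iff _).1 ((mem_perp_ω₂ p w₁).1 hb1)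
  obtain ⟨c1, c2⟩ := (tangentFst_eq_zero_iff _).1 ((mem_perp_ω₁ p w₂).1 hb2)
  have h01 := (mirror_ω₁_apply p v w₁).symm.trans h01
  have h02 := (mirror_ω₂_apply p v w₂).symm.trans h02
  have g00 := (mirror_g_apply p v v).symm.trans g00
  have g01 := (mirror_g_apply p v w₁).symm.trans g01
  have g02 := (mirror_g_apply p v w₂).symm.trans g02
  have g11 := (mirror_g_apply p w₁ w₁).symm.trans g11
  have g22 := (mirror_g_apply p w₂ w₂).symm.trans g22
  simp [a1, a2, c1, c2, hτ.ne', ht.ne'] at h01 h02 g01 g02 g00 g11 g22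
  -- Orthogonality of v and w¹ makes one of their x-components vanish; that of w¹ cannot, because
  -- ω₁(v, w¹) = 1.
  have v1 : v.1.1.re = 0 := by
    refine g01.resolve_right fun h => ?_
    simp [h] at h01
  have v2 : v.1.2.re = 0 := by
    refine g02.resolve_right fun h => ?_
    simp [h] at h02
  rw [v1, v2] at g00
  have hh : τ.im * t.im * tangentBase τ t v ^ 2 = 1 := by rw [← g00]; ring
  refine ⟨tangentBase τ t v, hh, ?_, ?_, ?_⟩
  · exact fibreTangent_ext (by simp) v1 v2
  · refine fibreTangent_ext (by simpa using a1) ?_ a2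
    rw [re_fst_fibreVector]
    linear_combination (τ.im * tangentBase τ t v) * h01 - w₁.1.1.re * hh
  · refine fibreTangent_ext (by simpa using c1) c2 ?_
    rw [re_snd_fibreVector]
    linear_combination (t.im * tangentBase τ t v) * h02 - w₂.1.2.re * hh

theorem exists_scale (τ t : UpperHalfPlane) : ∃ h : ℝ, 0 < h ∧ τ.im * t.im * h ^ 2 = 1 := by
  have h := mul_pos τ.im_pos t.im_pos
  refine ⟨(Real.sqrt (τ.im * t.im))⁻¹, by positivity, ?_⟩
  rw [inv_pow, Real.sq_sqrt h.le, mul_inv_cancel₀ h.ne']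

end Adapted

/-! ### Self-duality -/

section SelfDual

variable {τ t : UpperHalfPlane}

theorem IsAdaptedBasis.eq_scaledFrame {p : fibreProduct τ t}
    {b : Basis (Fin 3 × Fin 1) ℝ (TangentSpace 𝓘(ℝ, fibreTangent τ t) p)}
    (hb : (mirrorManifold τ t).IsAdaptedBasis p b) :
    ∃ (h : ℝ) (hh : τ.im * t.im * h ^ 2 = 1), b = scaledFrame τ t h hh := by
  obtain ⟨h, hh, h0, h1, h2⟩ := IsAdaptedBasis.eq_fibreVector hb
  refine ⟨h, hh, Basis.eq_of_apply_eq ?_⟩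
  obtain ⟨k0, k1, k2⟩ := scaledFrame_apply h hh
  rintro ⟨i, j⟩
  rw [Subsingleton.elim j 0]
  fin_cases i
  · exact h0.trans k0.symm
  · exact h1.trans k1.symm
  · exact h2.trans k2.symm

variable (τ t) in
/-- The form `dx ∧ dy`. -/
def constDual : fibreTangent τ t [⋀^Fin 2]→L[ℝ] ℝ where
  toFun m := (m 0).1.1.re * (m 1).1.2.re - (m 1).1.1.re * (m 0).1.2.re
  map_update_add' := by
    intro inst m i x y
    rw [Subsingleton.elim inst (instDecidableEqFin 2)]
    fin_cases i <;> simp <;> ring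
  map_update_smul' := by
    intro inst m i c x
    rw [Subsingleton.elim inst (instDecidableEqFin 2)]
    fin_cases i <;> simp <;> ring
  cont := by fun_prop
  map_eq_zero_of_eq' := by
    intro m i j hij hne
    fin_cases i <;> fin_cases j <;> simp_all

theorem constMetric_self_pos {u : fibreTangent τ t} (hu : u ≠ 0) : 0 < constMetric τ t u u := by
  have hτ := τ.im_pos
  have ht := t.im_pos
  rw [constMetric_apply]
  have h1 : 0 ≤ t.im / τ.im * (u.1.1.re * u.1.1.re) :=
    mul_nonneg (by positivity) (mul_self_nonneg _)
  have h2 : 0 ≤ τ.im / t.im * (u.1.2.re * u.1.2.re) :=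
    mul_nonneg (by positivity) (mul_self_nonneg _)
  have h3 : 0 ≤ τ.im * t.im * (tangentBase τ t u * tangentBase τ t u) :=
    mul_nonneg (by positivity) (mul_self_nonneg _)
  refine lt_of_le_of_ne (by positivity) fun h0 => hu ?_
  have e1 : t.im / τ.im * (u.1.1.re * u.1.1.re) = 0 := by linarith
  have e2 : τ.im / t.im * (u.1.2.re * u.1.2.re) = 0 := by linarith
  have e3 : τ.im * t.im * (tangentBase τ t u * tangentBase τ t u) = 0 := by linarith
  simp [hτ.ne', ht.ne'] at e1 e2 e3
  exact fibreTangent_ext (by simpa using e3) e1 e2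

/-- On the compact unit sphere the positive definite form has a positive minimum m, so its unit ball
lies in the norm ball of radius m^(-1/2). -/
theorem isVonNBounded_constMetric :
    Bornology.IsVonNBounded ℝ {u : fibreTangent τ t | constMetric τ t u u < 1} := by
  refine (NormedSpace.isVonNBounded_iff ℝ (E := fibreTangent τ t)).2 ?_
  have hcont : Continuous fun u : fibreTangent τ t => constMetric τ t u u := by fun_prop
  by_cases hne : (Metric.sphere (0 : fibreTangent τ t) 1).Nonempty
  · obtain ⟨u₀, hu₀, hmin⟩ := (isCompact_sphere (0 : fibreTangent τ t) 1).exists_isMinOn hne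
      hcont.continuousOn
    have hu₀' : u₀ ≠ 0 := by
      rintro rfl
      simp at hu₀
    have hpos := constMetric_self_pos hu₀'
    set m := constMetric τ t u₀ u₀
    refine (Metric.isBounded_closedBall (x := (0 : fibreTangent τ t)) (r := √(m⁻¹))).subset ?_
    intro u hu
    rw [mem_closedBall_zero_iff]
    apply Real.le_sqrt_of_sq_le
    by_cases h0 : u = 0
    · simp [h0, hpos.le]
    have hn : 0 < ‖u‖ := norm_pos_iff.2 h0
    have h1 : m ≤ constMetric τ t (‖u‖⁻¹ • u) (‖u‖⁻¹ • u) :=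
      hmin (by rw [mem_sphere_zero_iff_norm, norm_smul, norm_inv, norm_norm,
        inv_mul_cancel₀ hn.ne'])
    simp only [map_smul, smul_apply, smul_eq_mul] at h1
    have h2 : constMetric τ t u u < 1 := hu
    have h3 : m * ‖u‖ ^ 2 ≤ constMetric τ t u u := by
      calc m * ‖u‖ ^ 2 ≤ ‖u‖⁻¹ * (‖u‖⁻¹ * constMetric τ t u u) * ‖u‖ ^ 2 := by gcongr
        _ = constMetric τ t u u := by field_simp
    rw [← one_div, le_div_iff₀ hpos]
    linarith
  · refine (Metric.isBounded_closedBall (x := (0 : fibreTangent τ t)) (r := 0)).subset ?_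
    intro u _
    by_contra h0
    have hn : 0 < ‖u‖ := by simpa using h0
    exact hne ⟨‖u‖⁻¹ • u, by rw [mem_sphere_zero_iff_norm, norm_smul, norm_inv, norm_norm,
      inv_mul_cancel₀ hn.ne']⟩

variable (τ t) in
/-- The metric of `mirrorManifold` as a smooth Riemannian metric. -/
def mirrorMetric : Bundle.ContMDiffRiemannianMetric 𝓘(ℝ, fibreTangent τ t) ∞ (fibreTangent τ t)
    (fun p : fibreProduct τ t => TangentSpace 𝓘(ℝ, fibreTangent τ t) p) where
  inner := (mirrorManifold τ t).g
  symm p u u' := by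
    rw [mirror_g_eq]
    refine (constMetric_apply (τ := τ) (t := t) u u').trans
      (Eq.trans ?_ (constMetric_apply (τ := τ) (t := t) u' u).symm)
    ring
  pos p u hu := by
    rw [mirror_g_eq]
    exact constMetric_self_pos (τ := τ) (t := t) hu
  isVonNBounded p := by
    rw [mirror_g_eq]
    exact isVonNBounded_constMetric (τ := τ) (t := t)
  contMDiff := (isTranslationCover_fibreCover τ t).contMDiff_const_bilin (constMetric τ t) _
    mirror_g_eq

variable (τ t) in
theorem mirror_isAlmostTwoKahler : (mirrorManifold τ t).IsAlmostTwoKahler 1 where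
  t2 := inferInstance
  secondCountable := TopologicalSpace.Subtype.secondCountableTopology
    (fibreProduct τ t : Set ((standard τ t).Carrier × (standard t τ).Carrier))
  smooth₁ := (isTranslationCover_fibreCover τ t).isSmooth_const mirror_ω₁_eq
  smooth₂ := (isTranslationCover_fibreCover τ t).isSmooth_const mirror_ω₂_eq
  closed₁ := (isTranslationCover_fibreCover τ t).isClosed_const mirror_ω₁_eq
  closed₂ := (isTranslationCover_fibreCover τ t).isClosed_const mirror_ω₂_eq
  riemannian := ⟨mirrorMetric τ t, fun _ => rfl⟩
  adapted p := by
    obtain ⟨h, -, hh⟩ := exists_scale τ t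
    exact ⟨scaledFrame τ t h hh, scaledFrame_isAdaptedBasis p h hh⟩
  integrable := by
    refine (isTranslationCover_fibreCover τ t).isIntegrable_const
      (F := LinearMap.ker (tangentBase τ t).toLinearMap) fun p => ?_
    ext u
    exact mem_vertical p u

/-- The coordinates dual to w¹, w² are Im t h x and Im τ h y. The product of their scales is Im τ Im
t h² = 1, so the sign of h drops out. -/
theorem isDualizingForm_constDual :
    (mirrorManifold τ t).IsDualizingForm 1 (fun _ => constDual τ t) := by
  intro p b hb u u'
  obtain ⟨h, hh, rfl⟩ := IsAdaptedBasis.eq_scaledFrame hb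
  simp only [Fin.sum_univ_one, Fin.isValue]
  erw [scaledFrame_coord, scaledFrame_coord, scaledFrame_coord, scaledFrame_coord]
  simp only [Matrix.cons_val]
  change fibreTangent τ t at u u'
  change u.1.1.re * u'.1.2.re - u'.1.1.re * u.1.2.re = _
  linear_combination (-(u.1.1.re * u'.1.2.re - u'.1.1.re * u.1.2.re)) * hh

/-- The parametrization of a leaf of `ω₁^⊥ + ω₂^⊥`. -/
def leafParam (v : fibreTangent τ t) (y : EuclideanSpace ℝ (Fin 2)) : fibreProduct τ t :=
  fibreCover τ t (v + fibreVector τ t 0 (y 0) (y 1))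

/-- The differential of `leafParam`. -/
def leafTangent : EuclideanSpace ℝ (Fin 2) →L[ℝ] fibreTangent τ t :=
  LinearMap.toContinuousLinearMap
    { toFun := fun y => fibreVector τ t 0 (y 0) (y 1)
      map_add' := fun y z => fibreTangent_ext (by simp) rfl rfl
      map_smul' := fun c y => fibreTangent_ext (by simp) (by simp) (by simp) }

theorem hasMFDerivAt_leafParam (v : fibreTangent τ t) (y : EuclideanSpace ℝ (Fin 2)) :
    HasMFDerivAt 𝓘(ℝ, EuclideanSpace ℝ (Fin 2)) 𝓘(ℝ, fibreTangent τ t) (leafParam v) y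
      (leafTangent (τ := τ) (t := t)) := by
  have h : HasFDerivAt (fun y => v + leafTangent (τ := τ) (t := t) y)
    (leafTangent (τ := τ) (t := t)) y := (ContinuousLinearMap.hasFDerivAt _).const_add v
  exact ((isTranslationCover_fibreCover τ t).hasMFDerivAt (𝕜 := ℝ) _).comp y h.hasMFDerivAt

theorem contMDiff_leafParam (v : fibreTangent τ t) :
    ContMDiff 𝓘(ℝ, EuclideanSpace ℝ (Fin 2)) 𝓘(ℝ, fibreTangent τ t) ∞ (leafParam v) := by
  have h : ContDiff ℝ ∞ (fun y => v + leafTangent (τ := τ) (t := t) y) :=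
    contDiff_const.add (ContinuousLinearMap.contDiff _)
  exact (isTranslationCover_fibreCover τ t).contMDiff.comp h.contMDiff

theorem injective_leafTangent : Injective (leafTangent (τ := τ) (t := t)) := by
  intro y z h
  ext i
  fin_cases i
  · exact congrArg (fun u : fibreTangent τ t => u.1.1.re) h
  · exact congrArg (fun u : fibreTangent τ t => u.1.2.re) h

/-- The half-open unit square. -/
def unitSquare : Set (EuclideanSpace ℝ (Fin 2)) := {y | ∀ i, y i ∈ Ico (0 : ℝ) 1}

theorem unitSquare_eq : unitSquare = (MeasurableEquiv.toLp 2 (Fin 2 → ℝ)).symm ⁻¹'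
    (univ.pi fun _ => Ico (0 : ℝ) 1) := by
  ext y
  simp only [unitSquare, mem_preimage, mem_univ_pi]
  rfl

theorem measurableSet_unitSquare : MeasurableSet unitSquare := by
  rw [unitSquare_eq]
  exact (MeasurableSet.univ_pi fun _ => measurableSet_Ico).preimage
    (MeasurableEquiv.toLp 2 (Fin 2 → ℝ)).symm.measurable

theorem volume_unitSquare : volume unitSquare = 1 := by
  rw [unitSquare_eq, (EuclideanSpace.volume_preserving_symm_measurableEquiv_toLp
    (Fin 2)).measure_preimage_equiv]
  simp [Real.volume_pi_Ico]

theorem injOn_leafParam (v : fibreTangent τ t) : InjOn (leafParam v) unitSquare := by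
  intro y hy z hz h
  obtain ⟨m, n, k, h1, h2, h3⟩ := (fibreCover_eq_iff _ _).1 h
  simp only [map_add, tangentBase_fibreVector, sub_self] at h1
  have hm : m = 0 := by exact_mod_cast h1.symm
  simp only [Submodule.coe_add, Prod.fst_add, Prod.snd_add, Complex.add_re, re_fst_fibreVector,
    re_snd_fibreVector, add_sub_add_left_eq_sub, hm, Int.cast_zero, zero_mul, zero_add] at h2 h3
  have key : ∀ (i : Fin 2) (n : ℤ), y i - z i = n → y i = z i := by
    intro i n hn
    have a := hy i
    have b := hz i
    have h1 : (n : ℝ) < 1 := by linarith [a.2, b.1]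
    have h2 : (-1 : ℝ) < n := by linarith [a.1, b.2]
    have h1' : n < 1 := by exact_mod_cast h1
    have h2' : -1 < n := by exact_mod_cast h2
    have : n = 0 := by omega
    rw [this] at hn
    simpa [sub_eq_zero] using hn
  ext i
  fin_cases i
  · exact key 0 n h2
  · exact key 1 k h3

theorem image_leafParam (v : fibreTangent τ t) :
    leafParam v '' unitSquare = (mirrorManifold τ t).vertical.leaf (fibreCover τ t v) := by
  ext q
  constructor
  · rintro ⟨y, -, rfl⟩
    exact (mem_leaf_vertical _ _).2 ⟨0, by simp⟩
  · intro hq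
    obtain ⟨u, rfl⟩ := fibreCover_surjective τ t q
    obtain ⟨m, hm⟩ := (mem_leaf_vertical _ _).1 hq
    -- Once the deck transformation aligning the s-coordinates is removed, the two remaining
    -- coordinates count only modulo integers.
    set x := u.1.1.re - v.1.1.re - m * τ.re
    set y := u.1.2.re - v.1.2.re - m * t.re
    refine ⟨!₂[Int.fract x, Int.fract y], ?_, ?_⟩
    · intro i
      fin_cases i
      · exact ⟨Int.fract_nonneg _, Int.fract_lt_one _⟩
      · exact ⟨Int.fract_nonneg _, Int.fract_lt_one _⟩
    · refine (fibreCover_eq_iff _ _).2 ⟨-m, -⌊x⌋, -⌊y⌋, ?_, ?_, ?_⟩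
      · simp [← hm]
      · have := Int.self_sub_floor x
        simp
        linarith
      · have := Int.self_sub_floor y
        simp
        linarith

/-- The Gram matrix of ∂_x, ∂_y is diagonal with entries Im t / Im τ and Im τ / Im t. Its
determinant is 1, so the volume is the area of the unit square. -/
theorem hasRiemannianVolume_leaf (p : fibreProduct τ t) :
    HasRiemannianVolume (mirrorManifold τ t).g 2 ((mirrorManifold τ t).vertical.leaf p) 1 := by
  obtain ⟨v, rfl⟩ := fibreCover_surjective τ t p
  have hτ := τ.im_pos.ne'
  have ht := t.im_pos.ne'
  -- One piece covers the leaf; all the others are empty.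
  refine ⟨fun _ => leafParam v, fun _ => univ, fun i => if i = 0 then unitSquare else ∅,
    fun i => ⟨isOpen_univ, (contMDiff_leafParam v).contMDiffOn, fun y _ => ?_, ?_,
      subset_univ _, ?_⟩, ?_, ?_, ?_⟩
  · rw [(hasMFDerivAt_leafParam v y).mfderiv]
    exact injective_leafTangent
  · dsimp only
    split_ifs
    exacts [measurableSet_unitSquare, MeasurableSet.empty]
  · dsimp only
    split_ifs
    exacts [injOn_leafParam v, injOn_empty _]
  · intro i j hij
    dsimp only
    split_ifs <;> simp_all
  · rw [← image_leafParam]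
    ext q
    simp only [mem_iUnion]
    constructor
    · rintro ⟨i, hi⟩
      by_cases h : i = 0 <;> simp_all
    · intro h
      exact ⟨0, by simpa using h⟩
  · have hone : ∀ y : EuclideanSpace ℝ (Fin 2), Matrix.det (Matrix.of fun a b : Fin 2 =>
        (mirrorManifold τ t).g (leafParam v y)
          (mfderiv 𝓘(ℝ, EuclideanSpace ℝ (Fin 2)) 𝓘(ℝ, fibreTangent τ t) (leafParam v) y
            (EuclideanSpace.single a (1 : ℝ)))
          (mfderiv 𝓘(ℝ, EuclideanSpace ℝ (Fin 2)) 𝓘(ℝ, fibreTangent τ t) (leafParam v) y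
            (EuclideanSpace.single b (1 : ℝ)))) = 1 := by
      intro y
      rw [(hasMFDerivAt_leafParam v y).mfderiv, mirror_g_eq]
      have h : ∀ a b : Fin 2, constMetric τ t
          (fibreVector τ t 0 (EuclideanSpace.single a (1 : ℝ) 0)
            (EuclideanSpace.single a (1 : ℝ) 1))
          (fibreVector τ t 0 (EuclideanSpace.single b (1 : ℝ) 0)
            (EuclideanSpace.single b (1 : ℝ) 1)) =
          !![t.im / τ.im, 0; 0, τ.im / t.im] a b := by
        intro a b
        rw [constMetric_apply]
        fin_cases a <;> fin_cases b <;> simp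
      have h' : Matrix.det (Matrix.of fun a b : Fin 2 => !![t.im / τ.im, 0; 0, τ.im / t.im] a b)
          = 1 := by
        rw [Matrix.det_fin_two]
        simp [hτ, ht]
      refine Eq.trans (congrArg Matrix.det ?_) h'
      ext a b
      exact h a b
    rw [tsum_eq_single 0]
    · simp only [hone, if_true]
      simp [volume_unitSquare]
    · intro i hi
      simp [hi]

variable (τ t) in
theorem mirror_isSelfDual : (mirrorManifold τ t).IsSelfDual 1 where
  toIsAlmostTwoKahler := mirror_isAlmostTwoKahler τ t
  dualizing_closed := ⟨fun _ => constDual τ t, isDualizingForm_constDual,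
    (isTranslationCover_fibreCover τ t).isSmooth_const fun _ => rfl,
    (isTranslationCover_fibreCover τ t).isClosed_const fun _ => rfl⟩
  leaf_volume p := hasRiemannianVolume_leaf p

end SelfDual

/-! ### Monodromy -/

section Monodromy

/-- A curve with velocity `± h w`, `a h² = 1`, in a space covered by translations is a line. -/
theorem IsTranslationCover.exists_eq_line {V : Type*} [NormedAddCommGroup V] [NormedSpace ℝ V]
    {X : Type*} [TopologicalSpace X] [AddCommGroup X] [ChartedSpace V X] {c : V →+ X}
    (hc : IsTranslationCover c) [IsManifold 𝓘(ℝ, V) ∞ X] {γ : ℝ → X}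
    (hγ : ContMDiff 𝓘(ℝ, ℝ) 𝓘(ℝ, V) ∞ γ) {v : V} (hv : c v = γ 0) {w : V} {ℓ : V →L[ℝ] ℝ}
    (hℓ : ℓ w = 1) {a : ℝ}
    (h : ∀ s, ∃ r : ℝ, a * r ^ 2 = 1 ∧ velocity (V := V) γ s = r • w) :
    ∃ r : ℝ, a * r ^ 2 = 1 ∧ (∀ s, γ s = c (v + (s * r) • w)) ∧
      ∀ s, velocity (V := V) γ s = r • w := by
  obtain ⟨Γ, hs, hΓ0, hΓ, hd⟩ := hc.exists_lift_curve hγ hv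
  choose r hr hvel using h
  have hdΓ : ∀ s, deriv Γ s = r s • w := fun s => (hd s).symm.trans (hvel s)
  have hr_eq : r = fun s => ℓ (deriv Γ s) := by
    funext s
    simp [hdΓ, hℓ]
  have hcont : Continuous r := by
    rw [hr_eq]
    exact ℓ.continuous.comp (hs.continuous_deriv (by simp))
  have ha : a ≠ 0 := by
    rintro rfl
    simpa using hr 0
  have hr0 : r 0 ≠ 0 := fun h0 => by simpa [h0] using hr 0
  -- The square of `r` is the constant 1 / `a`, and `r` is continuous on the connected line, so its
  -- sign cannot change.
  have hconst : ∀ s, r s = r 0 := by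
    intro s
    have hsq : EqOn (r ^ 2) ((fun _ => r 0) ^ 2) univ := fun x _ =>
      mul_left_cancel₀ ha ((hr x).trans (hr 0).symm)
    rcases isPreconnected_univ.eq_or_eq_neg_of_sq_eq hcont.continuousOn continuousOn_const hsq
      (fun _ => hr0) with h | h
    · exact h (mem_univ s)
    · exact absurd (self_eq_neg.1 (h (mem_univ (0 : ℝ)))) hr0
  refine ⟨r 0, hr 0, fun s => ?_, fun s => by rw [hvel, hconst]⟩
  have hder : ∀ s, HasDerivAt (fun s => Γ s - (s * r 0) • w) 0 s := by
    intro s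
    have h1 := (hs.differentiable (by simp) s).hasDerivAt
    have h2 := ((hasDerivAt_id s).mul_const (r 0)).smul_const w
    have h3 := h1.sub h2
    rw [hdΓ, hconst s] at h3
    simpa using! h3
  have := is_const_of_deriv_eq_zero (fun s => (hder s).differentiableAt)
    (fun s => (hder s).deriv) s 0
  simp only [zero_mul, zero_smul, sub_zero, hΓ0] at this
  rw [← hΓ, ← this, sub_add_cancel]

/-- The first positive time at which a line hits an integer. -/
theorem mul_eq_one_or_neg_one_of_first_return {L h : ℝ} (hL : 0 < L) (hh : h ≠ 0)
    (h1 : ∃ m : ℤ, L * h = m) (h2 : ∀ s, 0 < s → s < L → ¬∃ m : ℤ, s * h = m) :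
    L * h = 1 ∨ L * h = -1 := by
  obtain ⟨m, hm⟩ := h1
  have hpos : 0 < |h| := abs_pos.2 hh
  have habs : L * |h| = |(m : ℝ)| := by rw [← hm, abs_mul, abs_of_pos hL]
  -- At time 1 / |h| the line is at 1 or -1, so the first return is no later.
  have hle : L ≤ |h|⁻¹ := by
    by_contra! hlt
    refine h2 _ (inv_pos.2 hpos) hlt ?_
    rcases abs_cases h with ⟨h3, -⟩ | ⟨h3, -⟩
    · exact ⟨1, by rw [h3]; simp [hh]⟩
    · exact ⟨-1, by rw [h3]; simp [hh]⟩
  have hle' : |(m : ℝ)| ≤ 1 := by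
    rw [← habs]
    calc L * |h| ≤ |h|⁻¹ * |h| := by gcongr
      _ = 1 := inv_mul_cancel₀ hpos.ne'
  have hm0 : m ≠ 0 := by
    rintro rfl
    simp [hh, hL.ne'] at hm
  have hm1 : |m| ≤ 1 := by exact_mod_cast hle'
  rw [hm]
  have : m = 1 ∨ m = -1 := by
    rw [abs_le] at hm1
    omega
  rcases this with rfl | rfl <;> simp

variable {τ t : UpperHalfPlane}

theorem fibreVector_smul (r h x y : ℝ) :
    fibreVector τ t (r * h) (r * x) (r * y) = r • fibreVector τ t h x y :=
  fibreTangent_ext (by simp) (by simp) (by simp)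

variable (τ t) in
/-- The differential of the second real coordinate. -/
def tangentReSnd : fibreTangent τ t →L[ℝ] ℝ := Complex.reCLM.comp (tangentSnd τ t)

theorem covolume_standard : ZLattice.covolume (standard τ t).periods.lattice = τ.im := by
  have h := ZLattice.covolume_eq_det_mul_measureReal (standard τ t).periods.lattice
    (volume : Measure ℂ) (standard τ t).periods.latticeBasis Complex.basisOneI
  have h1 : volume.real (ZSpan.fundamentalDomain Complex.basisOneI) = 1 := by
    rw [measureReal_congr (ZSpan.fundamentalDomain_ae_parallelepiped Complex.basisOneI volume),
      measureReal_def]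
    have := Complex.orthonormalBasisOneI.volume_parallelepiped
    rw [← Complex.toBasis_orthonormalBasisOneI, OrthonormalBasis.coe_toBasis, this]
    rfl
  rw [h, h1, Basis.det_apply, Matrix.det_fin_two]
  simp only [Basis.toMatrix_apply, comp_apply, PeriodPair.latticeBasis_zero,
    PeriodPair.latticeBasis_one]
  simp [standard, abs_of_pos τ.im_pos]

/-- The denominator 2 Im τ of κ is cancelled by the covolume Im τ of the lattice and the factor -2
of the area form. -/
theorem standard_integral_im : (standard τ t).integral.im = t.re := by
  have := τ.im_pos.ne'
  rw [integral_im, covolume_standard, standard_κ_re]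
  field_simp

theorem isMonodromy_of_sub_int {θ : ℝ} {k : ℤ} (hθ : θ = t.re + k) :
    (mirrorManifold τ t).IsMonodromy θ := by
  have hτ := τ.im_pos
  have ht := t.im_pos
  obtain ⟨h, hpos, hh⟩ := exists_scale τ t
  have hcov := isTranslationCover_fibreCover τ t
  have hno : ∀ r s : ℝ, 0 < r → 0 < s → s < r⁻¹ → ¬∃ m : ℤ, s * r = m := by
    rintro r s hr h1 h2 ⟨m, hm⟩
    have h3 : 0 < s * r := mul_pos h1 hr
    have h4 : s * r < 1 := by
      calc s * r < r⁻¹ * r := by gcongr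
        _ = 1 := inv_mul_cancel₀ hr.ne'
    rw [hm] at h3 h4
    have h5 : (0 : ℤ) < m := by exact_mod_cast h3
    have h6 : m < 1 := by exact_mod_cast h4
    omega
  have hγs : ContDiff ℝ ∞ fun s : ℝ => s • fibreVector τ t h 0 0 := by fun_prop
  have hδs : ContDiff ℝ ∞ fun s : ℝ =>
      fibreVector τ t 1 0 0 + s • fibreVector τ t 0 0 (t.im * h) := by fun_prop
  have hγv : ∀ s, velocity (V := fibreTangent τ t)
      (fun s : ℝ => fibreCover τ t (s • fibreVector τ t h 0 0)) s = fibreVector τ t h 0 0 := by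
    intro s
    rw [hcov.velocity_eq (hγs.differentiable (by simp))]
    have := (hasDerivAt_id s).smul_const (fibreVector τ t h 0 0)
    rw [one_smul] at this
    exact this.deriv
  have hδv : ∀ s, velocity (V := fibreTangent τ t)
      (fun s : ℝ => fibreCover τ t (fibreVector τ t 1 0 0 + s • fibreVector τ t 0 0 (t.im * h))) s
        = fibreVector τ t 0 0 (t.im * h) := by
    intro s
    rw [hcov.velocity_eq (hδs.differentiable (by simp))]
    have := ((hasDerivAt_id s).smul_const (fibreVector τ t 0 0 (t.im * h))).const_add
      (fibreVector τ t 1 0 0)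
    rw [one_smul] at this
    exact this.deriv
  obtain ⟨f0, f1, f2⟩ := scaledFrame_apply h hh
  have hend : h⁻¹ • fibreVector τ t h 0 0 = fibreVector τ t 1 0 0 := by
    rw [← fibreVector_smul]
    simp [hpos.ne']
  -- The curve γ runs along ∂_s from the origin and returns to its leaf when s = 1, at time 1 / h.
  -- The curve δ continues along ∂_y and closes up when y has grown by 1, at time 1 / (h Im t).
  refine ⟨fun s => fibreCover τ t (s • fibreVector τ t h 0 0),
    fun s => fibreCover τ t (fibreVector τ t 1 0 0 + s • fibreVector τ t 0 0 (t.im * h)),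
    h⁻¹, (t.im * h)⁻¹, hcov.contMDiff_curve hγs,
    fun s => ⟨scaledFrame τ t h hh, scaledFrame_isAdaptedBasis _ h hh, (hγv s).trans f0.symm⟩,
    by positivity, ?_, ?_, hcov.contMDiff_curve hδs,
    fun s => ⟨scaledFrame τ t h hh, scaledFrame_isAdaptedBasis _ h hh, (hδv s).trans f2.symm⟩,
    ?_, ?_, by positivity, ?_, ?_, ?_⟩
  · exact (mem_leaf_vertical _ _).2 ⟨1, by simp [hpos.ne']⟩
  · intro s hs1 hs2 hmem
    obtain ⟨m, hm⟩ := (mem_leaf_vertical _ _).1 hmem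
    exact hno h s hpos hs1 hs2 ⟨m, by simpa using hm⟩
  · simp [hend]
  · rw [hγv, hδv]
    refine (mirror_ω₂_apply (τ := τ) (t := t) _ _ _).trans ?_
    simp
    linarith
  · refine (mem_leaf_ω₂ _ _).2 ⟨0, 1, by simp, ?_⟩
    simp
    field_simp
  · intro s hs1 hs2 hmem
    obtain ⟨m, k', hm, hk⟩ := (mem_leaf_ω₂ _ _).1 hmem
    simp only [zero_smul, add_zero, map_add, map_smul, tangentBase_fibreVector, smul_zero, sub_self]
      at hm
    have hm0 : m = 0 := by exact_mod_cast hm.symm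
    refine hno (t.im * h) s (by positivity) hs1 hs2 ⟨k', ?_⟩
    simpa [hm0] using hk
  -- One turn of the base shifts y by Re t; the integer `k` counts full turns of the fibre.
  · refine (mem_leaf_ω₂ _ _).2 ⟨1, k, by simp, ?_⟩
    simp only [Submodule.coe_add, Submodule.coe_smul, Prod.snd_add, Prod.smul_snd, Complex.add_re,
      Complex.smul_re, re_snd_fibreVector, smul_eq_mul, zero_mul]
    rw [mul_assoc, inv_mul_cancel₀ (by positivity), hθ]
    simp

/-- Both curves are lines by `IsTranslationCover.exists_eq_line`, each determined up to direction.
The orientation condition couples the two directions, and reversing both changes only the integer.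
-/
theorem exists_int_of_isMonodromy {θ : ℝ} (hM : (mirrorManifold τ t).IsMonodromy θ) :
    ∃ k : ℤ, θ = t.re + k := by
  have hτ := τ.im_pos
  have ht := t.im_pos
  have hcov := isTranslationCover_fibreCover τ t
  obtain ⟨γ, δ, L, ℓ, hγ, hγv, hL, hγL, hγn, hδ, hδv, hδ0, hor, hℓ, hδℓ, hδn, hend⟩ := hM
  obtain ⟨v, hv⟩ := fibreCover_surjective τ t (γ 0)
  obtain ⟨h, hh, hγeq, hγvel⟩ := hcov.exists_eq_line hγ hv (w := fibreVector τ t 1 0 0)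
    (ℓ := tangentBase τ t) (by simp) (a := τ.im * t.im) (fun s => by
      obtain ⟨b, hb, hbv⟩ := hγv s
      obtain ⟨h, hh, h0, -, -⟩ := IsAdaptedBasis.eq_fibreVector hb
      have e : fibreVector τ t h 0 0 = h • fibreVector τ t 1 0 0 := by
        rw [← fibreVector_smul]
        simp
      exact ⟨h, hh, (hbv.trans h0).trans e⟩)
  obtain ⟨h', hh', hδeq, hδvel⟩ := hcov.exists_eq_line hδ
    (v := v + (L * h) • fibreVector τ t 1 0 0) (by rw [hδ0, hγeq L])
    (w := fibreVector τ t 0 0 t.im)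
    (ℓ := t.im⁻¹ • tangentReSnd τ t) (by simp [tangentReSnd, tangentSnd, ht.ne'])
    (a := τ.im * t.im) (fun s => by
      obtain ⟨b, hb, hbv⟩ := hδv s
      obtain ⟨h, hh, -, -, h2⟩ := IsAdaptedBasis.eq_fibreVector hb
      have e : fibreVector τ t 0 0 (t.im * h) = h • fibreVector τ t 0 0 t.im := by
        rw [← fibreVector_smul]
        simp [mul_comm]
      exact ⟨h, hh, (hbv.trans h2).trans e⟩)
  rw [hγvel L, hδvel 0] at hor
  have hor' := (mirror_ω₂_apply (τ := τ) (t := t) _ _ _).symm.trans hor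
  simp at hor'
  have hh0 : h ≠ 0 := by rintro rfl; simp at hh
  -- The orientation condition reads Im τ Im t h h' = 1, while Im τ Im t h² = 1.
  have heq : h' = h := by
    have h1 : τ.im * t.im * h * (h' - h) = 0 := by linear_combination hor' - hh
    have h2 : τ.im * t.im * h ≠ 0 := by positivity
    linarith [(mul_eq_zero.1 h1).resolve_left h2]
  subst heq
  rw [hγeq L, ← hv, mem_leaf_vertical] at hγL
  rw [← hv] at hγn hend
  rw [hδeq ℓ, hδeq 0, mem_leaf_ω₂] at hδℓ
  rw [hδeq (θ * ℓ), mem_leaf_ω₂] at hend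
  simp at hγL hδℓ hend
  have hLh := mul_eq_one_or_neg_one_of_first_return hL hh0 hγL (fun s h1 h2 h3 => hγn s h1 h2 (by
    rw [hγeq s, mem_leaf_vertical]
    simpa using h3))
  have hth0 : t.im * h' ≠ 0 := by positivity
  have hℓh := mul_eq_one_or_neg_one_of_first_return hℓ hth0
    (by
      obtain ⟨m, hm, k, hk⟩ := hδℓ
      have hm0 : m = 0 := by exact_mod_cast hm.symm
      exact ⟨k, by rw [hm0] at hk; simp at hk; linarith⟩)
    (fun s h1 h2 h3 => hδn s h1 h2 (by
      obtain ⟨k, hk⟩ := h3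
      rw [hδeq s, hδeq 0, mem_leaf_ω₂]
      exact ⟨0, k, by simp, by simp; linarith⟩))
  obtain ⟨m, hm, k, hk⟩ := hend
  -- Both quantities are 1 or -1, and both have the sign of `h'`.
  have hsame : ℓ * (t.im * h') = L * h' := by
    rcases lt_or_gt_of_ne hh0 with hneg | hpos
    · have h1 : L * h' < 0 := mul_neg_of_pos_of_neg hL hneg
      have h2 : ℓ * (t.im * h') < 0 :=
        mul_neg_of_pos_of_neg hℓ (mul_neg_of_pos_of_neg ht hneg)
      rcases hLh with e1 | e1 <;> rcases hℓh with e2 | e2 <;> linarith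
    · have h1 : 0 < L * h' := mul_pos hL hpos
      have h2 : 0 < ℓ * (t.im * h') := by positivity
      rcases hLh with e1 | e1 <;> rcases hℓh with e2 | e2 <;> linarith
  have hk' : θ * (L * h') = (L * h') * t.re + k := by
    rw [← hsame]
    rw [← hm, ← hsame] at hk
    linear_combination hk
  rcases hLh with e | e
  · exact ⟨k, by rw [e] at hk'; linarith⟩
  · exact ⟨-k, by rw [e] at hk'; push_cast; linarith⟩

theorem isMonodromy_iff {θ : ℝ} :
    (mirrorManifold τ t).IsMonodromy θ ↔ ∃ k : ℤ, θ = t.re + k :=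
  ⟨exists_int_of_isMonodromy, fun ⟨_, hk⟩ => isMonodromy_of_sub_int hk⟩

end Monodromy

/-! ### Elliptic curves obtained from the fibre product -/

section Yields

variable {τ t : UpperHalfPlane}

theorem fibreFst_eq_iff (p q : fibreProduct τ t) : fibreFst τ t p = fibreFst τ t q ↔
    q ∈ (TwoFormField.perp (mirrorManifold τ t).ω₁).leaf p := by
  obtain ⟨u, rfl⟩ := fibreCover_surjective τ t p
  obtain ⟨u', rfl⟩ := fibreCover_surjective τ t q
  have hτ := τ.im_pos.ne'
  rw [mem_leaf_ω₁, eq_comm]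
  refine (proj_standard_eq_iff u'.1.1 u.1.1).trans ?_
  rw [im_fst, im_fst]
  simp only [← sub_mul, mul_left_inj' hτ]

variable (τ t) in
/-- The horizontal section of `tangentFst`. -/
def horizontalSection : ℂ →L[ℝ] fibreTangent τ t :=
  LinearMap.toContinuousLinearMap
    { toFun := fun z => fibreVector τ t (z.im / τ.im) z.re 0
      map_add' := fun y z => fibreTangent_ext (by simp [add_div]) (by simp) (by simp)
      map_smul' := fun c y => fibreTangent_ext (by simp [mul_div_assoc]) (by simp) (by simp) }

theorem horizontalSection_apply (z : ℂ) :
    horizontalSection τ t z = fibreVector τ t (z.im / τ.im) z.re 0 := rfl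

theorem tangentFst_horizontalSection (z : ℂ) : (horizontalSection τ t z).1.1 = z :=
  Complex.ext rfl (by
    rw [im_fst, horizontalSection_apply, tangentBase_fibreVector,
      div_mul_cancel₀ _ τ.im_pos.ne'])

/-- The projection is `fibreFst` followed by multiplication by `a`, an isometry of the two Kähler
metrics that also matches the Kähler forms. -/
theorem yieldsFirst_of_isSimilarity {E : KahlerEllipticCurve} {a : ℂ}
    (h : (standard τ t).IsSimilarity E a) (hM : (mirrorManifold τ t).IsMonodromy E.integral.im) :
    (mirrorManifold τ t).YieldsFirst E := by
  have hτ := τ.im_pos.ne'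
  have ht := t.im_pos.ne'
  have h1 : ∀ z ∈ (standard τ t).periods.lattice, a * z ∈ E.periods.lattice :=
    fun z hz => (h.mul_mem_iff z).2 hz
  set f := mulHom (standard τ t) E a h1
  have hinj : Injective f := by
    intro p q hpq
    obtain ⟨z, rfl⟩ := proj_surjective _ p
    obtain ⟨w, rfl⟩ := proj_surjective _ q
    rw [mulHom_proj, mulHom_proj, proj_eq_iff, ← mul_sub, h.mul_mem_iff] at hpq
    exact (proj_eq_iff _ _ _).2 hpq
  have hd : ∀ p : fibreProduct τ t, mfderiv 𝓘(ℝ, fibreTangent τ t) 𝓘(ℝ, ℂ)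
      (f ∘ fibreFst τ t) p = (ContinuousLinearMap.mul ℝ ℂ a).comp (tangentFst τ t) := fun p =>
    ((hasMFDerivAt_mulHom _ E a h1 _).comp p (hasMFDerivAt_fibreFst τ t p)).mfderiv
  have hκ : E.κ.im * Complex.normSq a = -(t.im / (2 * τ.im)) := h.im_eq.trans standard_κ_im
  rw [Complex.normSq_apply] at hκ
  refine ⟨⟨f ∘ fibreFst τ t, (contMDiff_mulHom_real _ E a h1).comp (contMDiff_fibreFst τ t),
    ?_, ?_, ?_, ?_, ?_⟩, hM⟩
  · intro e
    obtain ⟨z, rfl⟩ := E.proj_surjective e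
    refine ⟨fibreCover τ t (horizontalSection τ t (a⁻¹ * z)), ?_⟩
    change E.proj (a * (horizontalSection τ t (a⁻¹ * z)).1.1) = E.proj z
    rw [tangentFst_horizontalSection, mul_inv_cancel_left₀ h.ne_zero]
  · intro p
    rw [hd]
    intro z
    change ℂ at z
    refine ⟨horizontalSection τ t (a⁻¹ * z), ?_⟩
    change a * (horizontalSection τ t (a⁻¹ * z)).1.1 = z
    rw [tangentFst_horizontalSection, mul_inv_cancel_left₀ h.ne_zero]
  · intro p q
    rw [← fibreFst_eq_iff]
    exact hinj.eq_iff
  · intro p u u'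
    change fibreTangent τ t at u u'
    rw [hd]
    refine (mirror_ω₁_apply p u u').trans
      (Eq.trans ?_ (kahlerForm_apply E _ (a * u.1.1) (a * u'.1.1)).symm)
    simp only [Complex.mul_re, Complex.mul_im, im_fst]
    have e : t.im = -2 * (E.κ.im * (a.re * a.re + a.im * a.im)) * τ.im := by
      rw [hκ]; field_simp
    rw [e]
    ring
  · intro p u u' hu hu'
    change fibreTangent τ t at u u'
    -- The fibres run along ∂_y, so a horizontal vector has no y-component and its square length is
    -- (Im t / Im τ) |dz|².
    have hy : ∀ u : fibreTangent τ t, (∀ x, mfderiv 𝓘(ℝ, fibreTangent τ t) 𝓘(ℝ, ℂ)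
        (f ∘ fibreFst τ t) p x = 0 → (mirrorManifold τ t).g p u x = 0) → u.1.2.re = 0 := by
      intro u hu
      have h2 := (mirror_g_apply p u (fibreVector τ t 0 0 1)).symm.trans
        (hu (fibreVector τ t 0 0 1) (by
          rw [hd]
          have : tangentFst τ t (fibreVector τ t 0 0 1) = 0 :=
            (tangentFst_eq_zero_iff _).2 (by simp)
          change a * tangentFst τ t (fibreVector τ t 0 0 1) = 0
          rw [this, mul_zero]))
      simpa [hτ, ht] using h2
    rw [hd]
    refine (mirror_g_apply p u u').trans
      (Eq.trans ?_ (metric_apply E _ (a * u.1.1) (a * u'.1.1)).symm)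
    rw [hy u hu, hy u' hu']
    simp only [Complex.mul_re, Complex.mul_im, im_fst]
    have e₁ : t.im / τ.im = -2 * (E.κ.im * (a.re * a.re + a.im * a.im)) := by
      rw [hκ]; field_simp
    have e₂ : τ.im * t.im = -2 * (E.κ.im * (a.re * a.re + a.im * a.im)) * τ.im ^ 2 := by
      rw [hκ]; field_simp
    rw [e₁, e₂]
    ring

/-- A conformal, orientation preserving real linear map is complex linear. -/
theorem eq_mul_of_conformal {A : ℂ →L[ℝ] ℂ} {r : ℝ} (hr : 0 < r)
    (h11 : (A 1).re * (A 1).re + (A 1).im * (A 1).im = r)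
    (h1I : (A 1).re * (A Complex.I).re + (A 1).im * (A Complex.I).im = 0)
    (hf : (A Complex.I).im * (A 1).re - (A 1).im * (A Complex.I).re = r) (z : ℂ) :
    A z = z * A 1 := by
  -- The last two hypotheses are linear equations for A i with determinant |A 1|² = r, and i · A 1
  -- solves them.
  have hre : (A Complex.I).re = -(A 1).im := by
    apply mul_left_cancel₀ hr.ne'
    linear_combination (A 1).re * h1I - (A Complex.I).re * h11 - (A 1).im * hf
  have him : (A Complex.I).im = (A 1).re := by
    apply mul_left_cancel₀ hr.ne'
    linear_combination (A 1).im * h1I - (A Complex.I).im * h11 + (A 1).re * hf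
  have hI : A Complex.I = Complex.I * A 1 := by
    apply Complex.ext
    · simp [hre]
    · simp [him]
  have hz : z = z.re • (1 : ℂ) + z.im • Complex.I := by
    simp [Complex.re_add_im]
  conv_lhs => rw [hz]
  rw [map_add, map_smul, map_smul, hI, Complex.real_smul, Complex.real_smul]
  conv_rhs => rw [← Complex.re_add_im z]
  ring

/-- The complex structure of E is not part of the given data on π. It is recovered from form and
metric together: a map scaling both by the same constant is conformal and preserves orientation,
hence is holomorphic. -/
theorem exists_isSimilarity_of_yieldsFirst {E : KahlerEllipticCurve}
    (h : (mirrorManifold τ t).YieldsFirst E) : ∃ a, (standard τ t).IsSimilarity E a := by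
  obtain ⟨⟨π, hπ, -, -, hfib, hform, hmet⟩, -⟩ := h
  have hτ := τ.im_pos
  have ht := t.im_pos
  have hE := E.im_neg
  have hcov := isTranslationCover_fibreCover τ t
  have hker : ∀ (p : fibreProduct τ t) (x : fibreTangent τ t),
      mfderiv 𝓘(ℝ, fibreTangent τ t) 𝓘(ℝ, ℂ) π p x = 0 →
      tangentBase τ t x = 0 ∧ x.1.1.re = 0 := by
    intro p x hx
    rw [← tangentFst_eq_zero_iff, ← mem_perp_ω₁ p]
    intro u'
    refine (hform p x u').trans ?_
    rw [hx]
    refine (kahlerForm_apply E _ 0 _).trans ?_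
    simp
  -- By `hker` vertical vectors are multiples of ∂_y, so the slice y = 0 is horizontal and the
  -- condition of a Riemannian submersion applies to it.
  have hhor : ∀ (p : fibreProduct τ t) (z : ℂ) (x : fibreTangent τ t),
      mfderiv 𝓘(ℝ, fibreTangent τ t) 𝓘(ℝ, ℂ) π p x = 0 →
      (mirrorManifold τ t).g p (horizontalSection τ t z) x = 0 := by
    intro p z x hx
    obtain ⟨h1, h2⟩ := hker p x hx
    refine (mirror_g_apply p _ _).trans ?_
    rw [h1, h2, horizontalSection_apply]
    simp
  set σ : ℂ → fibreProduct τ t := fun z => fibreCover τ t (horizontalSection τ t z) with hσ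
  have hσs : ContMDiff 𝓘(ℝ, ℂ) 𝓘(ℝ, fibreTangent τ t) ∞ σ :=
    hcov.contMDiff.comp (horizontalSection τ t).contDiff.contMDiff
  have hσd : ∀ z, HasMFDerivAt 𝓘(ℝ, ℂ) 𝓘(ℝ, fibreTangent τ t) σ z (horizontalSection τ t) :=
    fun z => (hcov.hasMFDerivAt (𝕜 := ℝ) _).comp z
      (horizontalSection τ t).hasFDerivAt.hasMFDerivAt
  have hG : ContMDiff 𝓘(ℝ, ℂ) 𝓘(ℝ, ℂ) ∞ (fun z => π (σ z)) := hπ.comp hσs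
  obtain ⟨w, hw⟩ := E.proj_surjective (π (σ 0))
  obtain ⟨F, hFc, -, hF⟩ := E.isTranslationCover.exists_lift hG.continuous 0 hw
  have hFs : ContDiff ℝ ∞ F :=
    (E.isTranslationCover.contMDiff_of_lift hFc (by simpa only [hF] using hG)).contDiff
  have hFd : Differentiable ℝ F := hFs.differentiable (by simp)
  have hder : ∀ z ζ, fderiv ℝ F z ζ =
      mfderiv 𝓘(ℝ, fibreTangent τ t) 𝓘(ℝ, ℂ) π (σ z) (horizontalSection τ t ζ) := by
    intro z ζ
    have e1 := E.isTranslationCover.mfderiv_comp_lift (hFd z).mdifferentiableAt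
    have e2 := (((hπ.mdifferentiableAt (by simp)).hasMFDerivAt (x := σ z)).comp z (hσd z)).mfderiv
    have e3 : (fun z => E.proj (F z)) = π ∘ σ := funext hF
    rw [e3, e2, mfderiv_eq_fderiv] at e1
    exact (DFunLike.congr_fun e1 ζ).symm
  have hform' : ∀ z ζ ζ', -2 * E.κ.im * ((fderiv ℝ F z ζ).im * (fderiv ℝ F z ζ').re -
      (fderiv ℝ F z ζ').im * (fderiv ℝ F z ζ).re) =
      t.im / τ.im * (ζ.im * ζ'.re - ζ'.im * ζ.re) := by
    intro z ζ ζ'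
    rw [hder, hder]
    refine ((kahlerForm_apply E _ _ _).symm.trans (hform (σ z) _ _).symm).trans
      ((mirror_ω₁_apply _ _ _).trans ?_)
    simp only [horizontalSection_apply, tangentBase_fibreVector, re_fst_fibreVector]
    field_simp
  have hmet' : ∀ z ζ ζ', -2 * E.κ.im * ((fderiv ℝ F z ζ).re * (fderiv ℝ F z ζ').re +
      (fderiv ℝ F z ζ).im * (fderiv ℝ F z ζ').im) =
      t.im / τ.im * (ζ.re * ζ'.re + ζ.im * ζ'.im) := by
    intro z ζ ζ'
    rw [hder, hder]
    refine ((metric_apply E _ _ _).symm.trans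
      (hmet (σ z) _ _ (hhor (σ z) ζ) (hhor (σ z) ζ')).symm).trans ((mirror_g_apply _ _ _).trans ?_)
    simp only [horizontalSection_apply, tangentBase_fibreVector, re_fst_fibreVector,
      re_snd_fibreVector]
    field_simp
    ring
  set r := t.im / τ.im / (-2 * E.κ.im) with hr
  have hE' : 0 < -2 * E.κ.im := by linarith
  have hrpos : 0 < r := by positivity
  have hscale : ∀ {x y : ℝ}, -2 * E.κ.im * x = t.im / τ.im * y → x = r * y := by
    intro x y hxy
    rw [hr, div_mul_eq_mul_div, eq_div_iff hE'.ne']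
    linarith
  have hlin : ∀ z ζ, fderiv ℝ F z ζ = ζ * fderiv ℝ F z 1 := by
    intro z ζ
    refine eq_mul_of_conformal hrpos ?_ ?_ ?_ ζ
    · simpa using hscale (hmet' z 1 1)
    · simpa using hscale (hmet' z 1 Complex.I)
    · simpa using hscale (hform' z Complex.I 1)
  -- The real derivative is complex linear at every point: these are the Cauchy–Riemann equations.
  have hFC : ∀ z, HasDerivAt F (fderiv ℝ F z 1) z := by
    intro z
    refine (hasFDerivAt_of_restrictScalars ℝ (hFd z).hasFDerivAt ?_ :
      HasFDerivAt F (ContinuousLinearMap.toSpanSingleton ℂ (fderiv ℝ F z 1)) z)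
    ext ζ
    simp [hlin z ζ]
  have hFdiff : Differentiable ℂ F := fun z => (hFC z).differentiableAt
  have hF'diff : Differentiable ℂ (deriv F) := by
    have : ContDiff ℂ 1 (deriv F) := (hFdiff.contDiff (n := 2)).deriv' (n := 1)
    exact this.differentiable (by simp)
  have hnorm : ∀ z, Complex.normSq (deriv F z) = r := by
    intro z
    rw [(hFC z).deriv, Complex.normSq_apply]
    simpa using hscale (hmet' z 1 1)
  have hb : Bornology.IsBounded (range (deriv F)) := by
    refine (Metric.isBounded_closedBall (x := (0 : ℂ)) (r := √r)).subset ?_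
    rintro _ ⟨z, rfl⟩
    rw [mem_closedBall_zero_iff]
    apply Real.le_sqrt_of_sq_le
    rw [← Complex.normSq_eq_norm_sq, hnorm]
  have haff := eq_mul_add_of_isBounded_range_deriv hFdiff hF'diff hb
  refine ⟨deriv F 0, ?_, fun z => ?_, ?_⟩
  · intro h0
    have := hnorm 0
    rw [h0, map_zero] at this
    exact hrpos.ne this
  -- Points of the slice have equal images in E exactly when they lie on one leaf of ω₁^⊥, that is,
  -- when they agree in E_τ.
  · have h1 : deriv F 0 * z = F z - F 0 := by
      rw [haff z, haff 0]
      ring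
    rw [h1, ← proj_eq_iff, hF, hF, hfib, ← fibreFst_eq_iff]
    refine (proj_eq_iff (standard τ t) (horizontalSection τ t z).1.1
      (horizontalSection τ t 0).1.1).trans ?_
    rw [tangentFst_horizontalSection, tangentFst_horizontalSection, sub_zero]
  · have := hE.ne
    rw [hnorm, standard_κ_im, hr]
    field_simp

/-- The elliptic curves with complexified Kähler class obtained from the fibre product. -/
theorem mirror_yieldsFirst_iff (E : KahlerEllipticCurve) :
    (mirrorManifold τ t).YieldsFirst E ↔ E.Iso (standard τ t) := by
  rw [iso_iff, standard_integral_im]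
  constructor
  · intro h
    obtain ⟨a, ha⟩ := exists_isSimilarity_of_yieldsFirst h
    obtain ⟨k, hk⟩ := isMonodromy_iff.1 h.2
    exact ⟨⟨a⁻¹, ha.symm⟩, -k, by rw [hk]; push_cast; ring⟩
  · rintro ⟨⟨a, ha⟩, k, hk⟩
    exact yieldsFirst_of_isSimilarity ha.symm
      (isMonodromy_iff.2 ⟨-k, by push_cast; linarith⟩)

end Yields

/-! ### Invariance under isomorphisms -/

section Invariance

variable {V : Type*} [NormedAddCommGroup V] [NormedSpace ℝ V]
variable {X : Type*} [TopologicalSpace X] [ChartedSpace V X]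
variable {W : Type*} [NormedAddCommGroup W] [NormedSpace ℝ W]
variable {Y : Type*} [TopologicalSpace Y] [ChartedSpace W Y]

theorem velocity_comp {f : X → Y} (hf : ContMDiff 𝓘(ℝ, V) 𝓘(ℝ, W) ∞ f) {γ : ℝ → X}
    (hγ : ContMDiff 𝓘(ℝ, ℝ) 𝓘(ℝ, V) ∞ γ) (s : ℝ) :
    velocity (V := W) (f ∘ γ) s = mfderiv 𝓘(ℝ, V) 𝓘(ℝ, W) f (γ s) (velocity (V := V) γ s) := by
  unfold velocity
  rw [mfderiv_comp s (hf.mdifferentiableAt (by simp)) (hγ.mdifferentiableAt (by simp))]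
  rfl

theorem Diffeomorph.exists_eq_comp_curve (Φ : Diffeomorph 𝓘(ℝ, V) 𝓘(ℝ, W) X Y ∞) {γ : ℝ → Y}
    (hγ : ContMDiff 𝓘(ℝ, ℝ) 𝓘(ℝ, W) ∞ γ) :
    ∃ η : ℝ → X, ContMDiff 𝓘(ℝ, ℝ) 𝓘(ℝ, V) ∞ η ∧ γ = Φ ∘ η :=
  ⟨Φ.symm ∘ γ, Φ.symm.contMDiff.comp hγ, funext fun s => (Φ.apply_symm_apply (γ s)).symm⟩

theorem Diffeomorph.mem_leaf_iff (Φ : Diffeomorph 𝓘(ℝ, V) 𝓘(ℝ, W) X Y ∞)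
    {D : TangentDistribution V X} {D' : TangentDistribution W Y}
    (h : ∀ (p : X) (u : TangentSpace 𝓘(ℝ, V) p),
      mfderiv 𝓘(ℝ, V) 𝓘(ℝ, W) Φ p u ∈ D' (Φ p) ↔ u ∈ D p) (p q : X) :
    Φ q ∈ D'.leaf (Φ p) ↔ q ∈ D.leaf p := by
  constructor
  · rintro ⟨γ, hγ, hvel, h0, h1⟩
    obtain ⟨η, hη, rfl⟩ := Diffeomorph.exists_eq_comp_curve Φ hγ
    refine ⟨η, hη, fun s => ?_, Φ.injective h0, Φ.injective h1⟩
    have := hvel s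
    rw [velocity_comp Φ.contMDiff hη] at this
    exact (h _ _).1 this
  · rintro ⟨η, hη, hvel, rfl, rfl⟩
    refine ⟨Φ ∘ η, Φ.contMDiff.comp hη, fun s => ?_, rfl, rfl⟩
    rw [velocity_comp Φ.contMDiff hη]
    exact (h _ _).2 (hvel s)

namespace TwoFormsWithMetric

variable {D : TwoFormsWithMetric V X} {D' : TwoFormsWithMetric W Y}

/-- `Φ` is compatible with the forms and the metrics. -/
def IsCompatible (Φ : Diffeomorph 𝓘(ℝ, V) 𝓘(ℝ, W) X Y ∞) (D : TwoFormsWithMetric V X)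
    (D' : TwoFormsWithMetric W Y) : Prop :=
  ∀ (p : X) (u u' : TangentSpace 𝓘(ℝ, V) p),
    D'.ω₁ (Φ p) ![mfderiv 𝓘(ℝ, V) 𝓘(ℝ, W) Φ p u, mfderiv 𝓘(ℝ, V) 𝓘(ℝ, W) Φ p u']
      = D.ω₁ p ![u, u'] ∧
    D'.ω₂ (Φ p) ![mfderiv 𝓘(ℝ, V) 𝓘(ℝ, W) Φ p u, mfderiv 𝓘(ℝ, V) 𝓘(ℝ, W) Φ p u']
      = D.ω₂ p ![u, u'] ∧
    D'.g (Φ p) (mfderiv 𝓘(ℝ, V) 𝓘(ℝ, W) Φ p u) (mfderiv 𝓘(ℝ, V) 𝓘(ℝ, W) Φ p u')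
      = D.g p u u'

/-- The differential of a diffeomorphism. -/
def tangentEquiv (Φ : Diffeomorph 𝓘(ℝ, V) 𝓘(ℝ, W) X Y ∞) (p : X) :
    TangentSpace 𝓘(ℝ, V) p ≃L[ℝ] TangentSpace 𝓘(ℝ, W) (Φ p) :=
  Φ.mfderivToContinuousLinearEquiv (by simp) p

theorem mfderiv_surjective (Φ : Diffeomorph 𝓘(ℝ, V) 𝓘(ℝ, W) X Y ∞) (p : X) :
    Surjective (mfderiv 𝓘(ℝ, V) 𝓘(ℝ, W) Φ p) :=
  (tangentEquiv Φ p).surjective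

theorem Isomorphic.symm (h : D.Isomorphic D') : D'.Isomorphic D := by
  obtain ⟨Φ, hΦ⟩ := h
  refine ⟨Φ.symm, fun q u u' => ?_⟩
  have hd : ∀ w : W, mfderiv 𝓘(ℝ, V) 𝓘(ℝ, W) Φ (Φ.symm q)
      (mfderiv 𝓘(ℝ, W) 𝓘(ℝ, V) Φ.symm q w) = w := by
    intro w
    have h1 := mfderiv_comp q (I := 𝓘(ℝ, W)) (I' := 𝓘(ℝ, V)) (I'' := 𝓘(ℝ, W)) (g := Φ) (f := Φ.symm)
      (Φ.contMDiff.mdifferentiableAt (by simp)) (Φ.symm.contMDiff.mdifferentiableAt (by simp))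
    have h2 : ⇑Φ ∘ ⇑Φ.symm = id := funext fun s => Φ.apply_symm_apply s
    rw [h2, mfderiv_id] at h1
    exact (DFunLike.congr_fun h1 w).symm
  obtain ⟨e₁, e₂, e₃⟩ := hΦ (Φ.symm q) (mfderiv 𝓘(ℝ, W) 𝓘(ℝ, V) Φ.symm q u)
    (mfderiv 𝓘(ℝ, W) 𝓘(ℝ, V) Φ.symm q u')
  -- The base points Φ (Φ⁻¹ q) and q are only propositionally equal. Every tangent space is `W`
  -- itself, so vectors need no transport.
  have hform : ∀ (η : TwoFormField W Y) {y y' : Y} (_ : y = y') (a b a' b' : W) (_ : a = a')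
      (_ : b = b'), η y ![a, b] = η y' ![a', b'] := by
    rintro η y _ rfl a b _ _ rfl rfl
    rfl
  have hg : ∀ {y y' : Y} (_ : y = y') (a b a' b' : W) (_ : a = a')
      (_ : b = b'), D'.g y a b = D'.g y' a' b' := by
    rintro y _ rfl a b _ _ rfl rfl
    rfl
  exact ⟨e₁.symm.trans (hform D'.ω₁ (Φ.apply_symm_apply q) _ _ _ _ (hd u) (hd u')),
    e₂.symm.trans (hform D'.ω₂ (Φ.apply_symm_apply q) _ _ _ _ (hd u) (hd u')),
    e₃.symm.trans (hg (Φ.apply_symm_apply q) _ _ _ _ (hd u) (hd u'))⟩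

theorem Isomorphic.swap (h : D.Isomorphic D') : D.swap.Isomorphic D'.swap := by
  obtain ⟨Φ, hΦ⟩ := h
  exact ⟨Φ, fun p u u' => ⟨(hΦ p u u').2.1, (hΦ p u u').1, (hΦ p u u').2.2⟩⟩

theorem IsCompatible.mem_perp₁ {Φ : Diffeomorph 𝓘(ℝ, V) 𝓘(ℝ, W) X Y ∞}
    (h : IsCompatible Φ D D') (p : X) (u : TangentSpace 𝓘(ℝ, V) p) :
    mfderiv 𝓘(ℝ, V) 𝓘(ℝ, W) Φ p u ∈ TwoFormField.perp D'.ω₁ (Φ p) ↔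
      u ∈ TwoFormField.perp D.ω₁ p :=
  ⟨fun hu u' => (h p u u').1.symm.trans (hu _), fun hu w => by
    obtain ⟨u', rfl⟩ := mfderiv_surjective Φ p w
    exact (h p u u').1.trans (hu u')⟩

theorem IsCompatible.mem_perp₂ {Φ : Diffeomorph 𝓘(ℝ, V) 𝓘(ℝ, W) X Y ∞}
    (h : IsCompatible Φ D D') (p : X) (u : TangentSpace 𝓘(ℝ, V) p) :
    mfderiv 𝓘(ℝ, V) 𝓘(ℝ, W) Φ p u ∈ TwoFormField.perp D'.ω₂ (Φ p) ↔
      u ∈ TwoFormField.perp D.ω₂ p :=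
  ⟨fun hu u' => (h p u u').2.1.symm.trans (hu _), fun hu w => by
    obtain ⟨u', rfl⟩ := mfderiv_surjective Φ p w
    exact (h p u u').2.1.trans (hu u')⟩

theorem IsCompatible.mem_vertical {Φ : Diffeomorph 𝓘(ℝ, V) 𝓘(ℝ, W) X Y ∞}
    (h : IsCompatible Φ D D') (p : X) (u : TangentSpace 𝓘(ℝ, V) p) :
    mfderiv 𝓘(ℝ, V) 𝓘(ℝ, W) Φ p u ∈ D'.vertical (Φ p) ↔ u ∈ D.vertical p := by
  constructor
  · intro hu
    obtain ⟨a, ha, b, hb, hab⟩ := Submodule.mem_sup.1 hu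
    obtain ⟨a, rfl⟩ := mfderiv_surjective Φ p a
    obtain ⟨b, rfl⟩ := mfderiv_surjective Φ p b
    rw [← map_add] at hab
    have : a + b = u := (tangentEquiv Φ p).injective hab
    exact Submodule.mem_sup.2 ⟨a, (h.mem_perp₁ p a).1 ha, b, (h.mem_perp₂ p b).1 hb, this⟩
  · intro hu
    obtain ⟨a, ha, b, hb, rfl⟩ := Submodule.mem_sup.1 hu
    exact Submodule.mem_sup.2 ⟨_, (h.mem_perp₁ p a).2 ha, _, (h.mem_perp₂ p b).2 hb,
      (map_add _ _ _).symm⟩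

theorem IsCompatible.isAdaptedBasis {Φ : Diffeomorph 𝓘(ℝ, V) 𝓘(ℝ, W) X Y ∞}
    (h : IsCompatible Φ D D') {n : ℕ} {p : X}
    {b : Basis (Fin 3 × Fin n) ℝ (TangentSpace 𝓘(ℝ, W) (Φ p))} (hb : D'.IsAdaptedBasis (Φ p) b) :
    D.IsAdaptedBasis p (b.map (tangentEquiv Φ p).symm.toLinearEquiv) := by
  have hcoord : ∀ i (u : TangentSpace 𝓘(ℝ, V) p),
      (b.map (tangentEquiv Φ p).symm.toLinearEquiv).coord i u =
        b.coord i (mfderiv 𝓘(ℝ, V) 𝓘(ℝ, W) Φ p u) := fun i u => rfl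
  obtain ⟨h₁, h₂, h₃⟩ := hb
  refine ⟨fun u u' => ?_, fun u u' => ?_, fun k l => ?_⟩
  · simp only [hcoord, ← h₁, (h p u u').1]
  · simp only [hcoord, ← h₂, (h p u u').2.1]
  · have e : ∀ k, mfderiv 𝓘(ℝ, V) 𝓘(ℝ, W) Φ p
        (b.map (tangentEquiv Φ p).symm.toLinearEquiv k) = b k := fun k =>
      (tangentEquiv Φ p).apply_symm_apply (b k)
    rw [← (h p _ _).2.2, e, e, h₃]

theorem IsCompatible.exists_isAdaptedBasis_velocity {Φ : Diffeomorph 𝓘(ℝ, V) 𝓘(ℝ, W) X Y ∞}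
    (h : IsCompatible Φ D D') {n : ℕ} {η : ℝ → X} (hη : ContMDiff 𝓘(ℝ, ℝ) 𝓘(ℝ, V) ∞ η) {s : ℝ}
    {i : Fin 3 × Fin n}
    (hb : ∃ b : Basis (Fin 3 × Fin n) ℝ (TangentSpace 𝓘(ℝ, W) ((Φ ∘ η) s)),
      D'.IsAdaptedBasis ((Φ ∘ η) s) b ∧ velocity (V := W) (Φ ∘ η) s = b i) :
    ∃ b : Basis (Fin 3 × Fin n) ℝ (TangentSpace 𝓘(ℝ, V) (η s)),
      D.IsAdaptedBasis (η s) b ∧ velocity (V := V) η s = b i := by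
  obtain ⟨b, hb, hv⟩ := hb
  refine ⟨_, h.isAdaptedBasis (p := η s) hb, ?_⟩
  rw [velocity_comp Φ.contMDiff hη] at hv
  exact (tangentEquiv Φ (η s)).eq_symm_apply.2 hv

theorem IsCompatible.isMonodromy {Φ : Diffeomorph 𝓘(ℝ, V) 𝓘(ℝ, W) X Y ∞}
    (h : IsCompatible Φ D D') {θ : ℝ} (hM : D'.IsMonodromy θ) : D.IsMonodromy θ := by
  obtain ⟨γ, δ, L, ℓ, hγ, hγv, hL, hγL, hγn, hδ, hδv, hδ0, hor, hℓ, hδℓ, hδn, hend⟩ := hM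
  obtain ⟨γ, hγ', rfl⟩ := Diffeomorph.exists_eq_comp_curve Φ hγ
  obtain ⟨δ, hδ', rfl⟩ := Diffeomorph.exists_eq_comp_curve Φ hδ
  have hv := Diffeomorph.mem_leaf_iff Φ h.mem_vertical
  have h₂ := Diffeomorph.mem_leaf_iff Φ h.mem_perp₂
  have hδ0' : δ 0 = γ L := Φ.injective hδ0
  refine ⟨γ, δ, L, ℓ, hγ', fun s => h.exists_isAdaptedBasis_velocity hγ' (hγv s), hL,
    (hv _ _).1 hγL, fun s h1 h2 h3 => hγn s h1 h2 ((hv _ _).2 h3), hδ',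
    fun s => h.exists_isAdaptedBasis_velocity hδ' (hδv s), hδ0', ?_, hℓ, (h₂ _ _).1 hδℓ,
    fun s h1 h2 h3 => hδn s h1 h2 ((h₂ _ _).2 h3), (h₂ _ _).1 hend⟩
  -- The velocity of δ is based at `δ 0`, that of γ at `γ L`; the two points agree only through
  -- `hδ0'`.
  have e : ∀ {x x' : X} (_ : x = x') (u : V), (mfderiv 𝓘(ℝ, V) 𝓘(ℝ, W) Φ x u : W) =
      mfderiv 𝓘(ℝ, V) 𝓘(ℝ, W) Φ x' u := by
    rintro x _ rfl u
    rfl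
  have hform : ∀ (y : Y) (a a' b b' : W) (_ : a = a') (_ : b = b'),
      D'.ω₂ y ![a, b] = D'.ω₂ y ![a', b'] := by
    rintro y a _ b _ rfl rfl
    rfl
  exact (h (γ L) _ _).2.1.symm.trans ((hform _ _ _ _ _ (velocity_comp Φ.contMDiff hγ' L).symm
    ((e hδ0'.symm _).trans (velocity_comp Φ.contMDiff hδ' 0).symm)).trans hor)

theorem IsCompatible.yieldsFirst {Φ : Diffeomorph 𝓘(ℝ, V) 𝓘(ℝ, W) X Y ∞}
    (h : IsCompatible Φ D D') {E : KahlerEllipticCurve} (hE : D'.YieldsFirst E) :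
    D.YieldsFirst E := by
  obtain ⟨⟨π, hπ, hsurj, hsub, hfib, hform, hmet⟩, hM⟩ := hE
  have hd : ∀ (p : X) (u : TangentSpace 𝓘(ℝ, V) p), mfderiv 𝓘(ℝ, V) 𝓘(ℝ, ℂ) (π ∘ Φ) p u =
      mfderiv 𝓘(ℝ, W) 𝓘(ℝ, ℂ) π (Φ p) (mfderiv 𝓘(ℝ, V) 𝓘(ℝ, W) Φ p u) := by
    intro p u
    rw [mfderiv_comp p (hπ.mdifferentiableAt (by simp)) (Φ.contMDiff.mdifferentiableAt (by simp))]
    rfl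
  refine ⟨⟨π ∘ Φ, hπ.comp Φ.contMDiff, hsurj.comp Φ.surjective, fun p e => ?_, fun p q => ?_,
    fun p u u' => ?_, fun p u u' hu hu' => ?_⟩, h.isMonodromy hM⟩
  · obtain ⟨w, hw⟩ := hsub (Φ p) e
    obtain ⟨u, rfl⟩ := mfderiv_surjective Φ p w
    exact ⟨u, (hd p u).trans hw⟩
  · exact (hfib _ _).trans (Diffeomorph.mem_leaf_iff Φ h.mem_perp₁ p q)
  · rw [hd, hd, ← (h p u u').1]
    exact hform _ _ _
  · have hhor : ∀ u : TangentSpace 𝓘(ℝ, V) p, (∀ x, mfderiv 𝓘(ℝ, V) 𝓘(ℝ, ℂ) (π ∘ Φ) p x = 0 →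
        D.g p u x = 0) → ∀ y, mfderiv 𝓘(ℝ, W) 𝓘(ℝ, ℂ) π (Φ p) y = 0 →
        D'.g (Φ p) (mfderiv 𝓘(ℝ, V) 𝓘(ℝ, W) Φ p u) y = 0 := by
      intro u hu y hy
      obtain ⟨x, rfl⟩ := mfderiv_surjective Φ p y
      rw [(h p u x).2.2]
      exact hu x ((hd p x).trans hy)
    rw [hd, hd, ← (h p u u').2.2]
    exact hmet _ _ _ (hhor u hu) (hhor u' hu')

theorem Isomorphic.yieldsFirst_iff (h : D.Isomorphic D') (E : KahlerEllipticCurve) :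
    D.YieldsFirst E ↔ D'.YieldsFirst E := by
  constructor
  · obtain ⟨Φ, hΦ⟩ := h.symm
    exact IsCompatible.yieldsFirst hΦ
  · obtain ⟨Φ, hΦ⟩ := h
    exact IsCompatible.yieldsFirst hΦ

theorem Isomorphic.refl (D : TwoFormsWithMetric V X) : D.Isomorphic D :=
  ⟨Diffeomorph.refl _ _ _, fun p u u' => by
    have h : mfderiv 𝓘(ℝ, V) 𝓘(ℝ, V) (Diffeomorph.refl 𝓘(ℝ, V) X ∞) p =
        ContinuousLinearMap.id ℝ _ := mfderiv_id
    rw [h]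
    exact ⟨rfl, rfl, rfl⟩⟩

end TwoFormsWithMetric

end Invariance

/-! ### The symmetry exchanging τ and t. -/

section Exchange

variable (τ t : UpperHalfPlane)

/-- The exchange of the two factors of the fibre product. -/
def fibreSwap (p : fibreProduct τ t) : fibreProduct t τ := ⟨(p.1.2, p.1.1), p.2.symm⟩

/-- The differential of `fibreSwap`. -/
def tangentSwap : fibreTangent τ t →L[ℝ] fibreTangent t τ where
  toFun u := ⟨(u.1.2, u.1.1), u.2.symm⟩
  map_add' _ _ := rfl
  map_smul' _ _ := rfl
  cont := by fun_prop

theorem hasMFDerivAt_fibreSwap (p : fibreProduct τ t) :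
    HasMFDerivAt 𝓘(ℝ, fibreTangent τ t) 𝓘(ℝ, fibreTangent t τ) (fibreSwap τ t) p
      (tangentSwap τ t) := by
  refine (isTranslationCover_fibreCover τ t).hasMFDerivAt_of_comp fun v _ => ?_
  exact ((isTranslationCover_fibreCover t τ).hasMFDerivAt (𝕜 := ℝ) (tangentSwap τ t v)).comp v
    (tangentSwap τ t).hasFDerivAt.hasMFDerivAt

theorem contMDiff_fibreSwap :
    ContMDiff 𝓘(ℝ, fibreTangent τ t) 𝓘(ℝ, fibreTangent t τ) ∞ (fibreSwap τ t) := by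
  rw [(isTranslationCover_fibreCover τ t).contMDiff_iff]
  exact (isTranslationCover_fibreCover t τ).contMDiff.comp (tangentSwap τ t).contDiff.contMDiff

/-- The coordinate s may be computed from either factor: this is the defining condition of the fibre
product. -/
theorem tangentBase_tangentSwap (u : fibreTangent τ t) :
    tangentBase t τ (tangentSwap τ t u) = tangentBase τ t u := by
  have ht := t.im_pos.ne'
  apply mul_right_cancel₀ ht
  rw [← im_snd u, ← im_fst (tangentSwap τ t u)]
  rfl

/-- The exchange of the two factors as a diffeomorphism. -/
def fibreSwapDiffeomorph : Diffeomorph 𝓘(ℝ, fibreTangent τ t) 𝓘(ℝ, fibreTangent t τ)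
    (fibreProduct τ t) (fibreProduct t τ) ∞ where
  toFun := fibreSwap τ t
  invFun := fibreSwap t τ
  left_inv _ := rfl
  right_inv _ := rfl
  contMDiff_toFun := contMDiff_fibreSwap τ t
  contMDiff_invFun := contMDiff_fibreSwap t τ

/-- The construction treats both factors alike, so the second relation for X_{τ,t} is the first one
for X_{t,τ} and needs no separate computation. -/
theorem swap_mirrorManifold_isomorphic :
    (mirrorManifold τ t).swap.Isomorphic (mirrorManifold t τ) := by
  refine ⟨fibreSwapDiffeomorph τ t, fun p u u' => ?_⟩
  have hd : mfderiv 𝓘(ℝ, fibreTangent τ t) 𝓘(ℝ, fibreTangent t τ) (fibreSwapDiffeomorph τ t) p =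
    tangentSwap τ t := (hasMFDerivAt_fibreSwap τ t p).mfderiv
  rw [hd]
  change fibreTangent τ t at u u'
  refine ⟨(mirror_ω₁_apply _ _ _).trans (Eq.trans ?_ (mirror_ω₂_apply p u u').symm),
    (mirror_ω₂_apply _ _ _).trans (Eq.trans ?_ (mirror_ω₁_apply p u u').symm),
    (mirror_g_apply _ _ _).trans (Eq.trans ?_ (mirror_g_apply p u u').symm)⟩
  · change τ.im * (tangentBase t τ (tangentSwap τ t u) * u'.1.2.re -
      tangentBase t τ (tangentSwap τ t u') * u.1.2.re) = _
    rw [tangentBase_tangentSwap, tangentBase_tangentSwap]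
  · change t.im * (tangentBase t τ (tangentSwap τ t u) * u'.1.1.re -
      tangentBase t τ (tangentSwap τ t u') * u.1.1.re) = _
    rw [tangentBase_tangentSwap, tangentBase_tangentSwap]
  · change τ.im / t.im * (u.1.2.re * u'.1.2.re) + t.im / τ.im * (u.1.1.re * u'.1.1.re) +
      t.im * τ.im * (tangentBase t τ (tangentSwap τ t u) * tangentBase t τ (tangentSwap τ t u')) = _
    rw [tangentBase_tangentSwap, tangentBase_tangentSwap]
    ring

end Exchange

/-! ### Conclusion. -/

theorem yields_iff_of_isomorphic {τ t : UpperHalfPlane} {V : Type*} [NormedAddCommGroup V]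
    [NormedSpace ℝ V] {X : Type*} [TopologicalSpace X] [ChartedSpace V X]
    {D : TwoFormsWithMetric V X} (h : D.Isomorphic (mirrorManifold τ t))
    (E : KahlerEllipticCurve) :
    (D.YieldsFirst E ↔ E.Iso (standard τ t)) ∧ (D.YieldsSecond E ↔ E.Iso (standard t τ)) :=
  ⟨(h.yieldsFirst_iff E).trans (mirror_yieldsFirst_iff E),
    (h.swap.yieldsFirst_iff E).trans
      (((swap_mirrorManifold_isomorphic τ t).yieldsFirst_iff E).trans (mirror_yieldsFirst_iff E))⟩

end

theorem mainTheorem2 :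
    (∀ τ t : UpperHalfPlane, (mirrorManifold τ t).IsSelfDual 1) ∧
    (∀ (τ t : UpperHalfPlane) {V : Type*} [NormedAddCommGroup V] [NormedSpace ℝ V]
      {X : Type*} [TopologicalSpace X] [ChartedSpace V X] [IsManifold 𝓘(ℝ, V) ∞ X]
      (D : TwoFormsWithMetric V X), D.Isomorphic (mirrorManifold τ t) →
      ∀ E : KahlerEllipticCurve,
        (D.YieldsFirst E ↔ E.Iso (KahlerEllipticCurve.standard τ t)) ∧
        (D.YieldsSecond E ↔ E.Iso (KahlerEllipticCurve.standard t τ))) ∧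
    (∀ E₁ E₂ : KahlerEllipticCurve, KahlerEllipticCurve.IsMirrorPair E₁ E₂ ↔
      ∃ τ t : UpperHalfPlane, (mirrorManifold τ t).IsSelfDual 1 ∧
        (mirrorManifold τ t).YieldsFirst E₁ ∧ (mirrorManifold τ t).YieldsSecond E₂) := by
  -- The mirror statement is proved for each fixed pair τ, t, since both sides use the same
  -- parameters.
  refine ⟨mirror_isSelfDual, ?_, fun E₁ E₂ => exists_congr fun τ => exists_congr fun t => ?_⟩
  · intro τ t V _ _ X _ _ _ D h E
    exact yields_iff_of_isomorphic h E
  · have h := TwoFormsWithMetric.Isomorphic.refl (mirrorManifold τ t)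
    rw [(yields_iff_of_isomorphic h E₁).1, (yields_iff_of_isomorphic h E₂).2]
    exact (and_iff_right (mirror_isSelfDual τ t)).symm
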